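/- **Setting.** All graphs are finite and simple, and $\rho(G)$ is the spectral radius of the adjacency matrix. $H(4,3)$ is the graph obtained by identifying a vertex of a $4$-cycle with a vertex of a triangle; $G$ is $H(4,3)$-free if it has no (not necessarily induced) subgraph isomorphic to $H(4,3)$. For even $m$ let $\rho'(m)$ be the largest real root of $p_m(x)=x^4-mx^2-(m-2)x+\frac m2-1$. For a vertex $u$ of $G$ put $N=N(u)$, $W=V(G)\setminus(N\cup\{u\})$, let $A^+$ be the set of vertices of $N$ having a neighbour in $N$, $A^0=N\setminus A^+$, and let $e(W)$ be the number of edges of $G[W]$. For even $m$, call $(G,u)$ *admissible* if $G$ is $H(4,3)$-free with $m$ edges, $G[A^+]\cong K_4$, $e(W)=1$, and every vertex of $W$ has degree at least $2$. Call $G$ *extremal* if it has the largest spectral radius among all $H(4,3)$-free graphs with $m$ edges and no isolated vertices. Consider three families of graphs with $m$ edges. Each consists of a $K_5$ on $\{u\}\cup A^+$ with $|A^+|=4$, an edge $xy$, and: 1. *same-$A^0$* ($m\ge14$): a vertex $z$ adjacent to $u,x,y$, and $m-14$ leaves attached to $u$; 2. *distinct-$A^0$* ($m\ge15$): distinct vertices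 $z_1,z_2$, both adjacent to $u$, with $z_1\sim x$ and $z_2\sim y$, and $m-15$ leaves attached to $u$; 3. *mixed* ($m\ge14$): a vertex $z$ adjacent to $u$ and $y$, the vertex $x$ adjacent to one vertex $a\in A^+$, and $m-14$ leaves attached to $u$. **Theorem.** Let $m$ be even. (a) If $G$ is extremal, has a positive Perron vector, and $u$ is a vertex at which this vector is maximal, then every $w\in W$ has degree at least $2$. Consequently, if in addition $G[A^+]\cong K_4$ and $e(W)=1$, then $(G,u)$ is admissible. (b) If $(G,u)$ is admissible, then $G$ is isomorphic, by an isomorphism carrying $u$ to $u$, to the member with $m$ edges of one of the three families; and no graph with $m$ edges is isomorphic to members of two different families. (c) For $m\ge16$ the partitions $\{u\},A^+,\{z\},\{x,y\},L$; $\{u\},A^+,\{z_1,z_2\},\{x,y\},L$; and $\{u\},\{a\},A^+\setminus\{a\},\{z\},\{x\},\{y\},L$ of the three graphs ($L$ being the set of leaves at $u$) are equitable, with quotient matrices $$\begin{pmatrix}0&4&1&0&m-14\\1&3&0&0&0\\1&0&0&2&0\\0&0&1&1&0\\1&0&0&0&0\end{pmatrix},\quad \begin{pmatrix}0&4&2&0&m-15\\1&3&0&0&0\\1&0&0&1&0\\0&0&1&1&0\\1&0&0&0&0\end{pmatrix},\quad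 \begin{pmatrix}0&1&3&1&0&0&m-14\\1&0&3&0&1&0&0\\1&1&2&0&0&0&0\\1&0&0&0&0&1&0\\0&1&0&0&0&1&0\\0&0&0&1&1&0&0\\1&0&0&0&0&0&0\end{pmatrix},$$ whose characteristic polynomials are, respectively, $$x^5-4x^4+(10-m)x^3+(4m-42)x^2+(19-m)x+84-6m,$$ $$x^5-4x^4+(11-m)x^3+(4m-45)x^2+(28-2m)x+45-3m,$$ $$x^7-2x^6+(3-m)x^5+(2m-24)x^4+(6m-61)x^3+(84-6m)x^2+(90-7m)x+2m-28.$$ (d) If $m\ge18$, the member with $m$ edges of each of the three families has spectral radius strictly less than $\rho'(m)$. (e) If $m\ge18$, then $\rho(G)<\rho'(m)$ for every admissible $(G,u)$; in particular this holds for every extremal $G$ with a positive Perron vector that is maximal at $u$, $G[A^+]\cong K_4$ and $e(W)=1$. -/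

import Mathlib

open Polynomial

/-- The fish graph `H(4,3)`: the 4-cycle `0 1 2 3` and the triangle `0 4 5` sharing the vertex `0`. -/
def fishGraph : SimpleGraph (Fin 6) :=
  SimpleGraph.fromRel fun i j =>
    (i, j) ∈ ([(0, 1), (1, 2), (2, 3), (3, 0), (0, 4), (4, 5), (5, 0)] : List (Fin 6 × Fin 6))

/-- The spectral radius `ρ(G)` of the adjacency matrix of a finite graph. -/
noncomputable def graphRho {V : Type*} [Fintype V] (G : SimpleGraph V) : ℝ :=
  open Classical in (spectralRadius ℝ (G.adjMatrix ℝ)).toReal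

/-- `p_m(x) = x⁴ - m x² - (m - 2) x + m / 2 - 1`. -/
noncomputable def pPoly (m : ℕ) : ℝ[X] :=
  X ^ 4 - C (m : ℝ) * X ^ 2 - C ((m : ℝ) - 2) * X + C ((m : ℝ) / 2 - 1)

/-- `ρ'(m)`, the largest real root of `p_m`. -/
noncomputable def rhoPrime (m : ℕ) : ℝ := sSup {x : ℝ | (pPoly m).IsRoot x}

/-- For `m ≥ 6` the supremum in `rhoPrime` is attained: it is the largest real root. -/
theorem rhoPrime_isGreatest (m : ℕ) (hm : 6 ≤ m) :
    IsGreatest {x : ℝ | (pPoly m).IsRoot x} (rhoPrime m) := by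
  have hm' : (6 : ℝ) ≤ m := by exact_mod_cast hm
  have hev : ∀ x : ℝ, (pPoly m).eval x
      = x ^ 4 - (m : ℝ) * x ^ 2 - ((m : ℝ) - 2) * x + ((m : ℝ) / 2 - 1) := by
    intro x; simp [pPoly]
  have h0 : pPoly m ≠ 0 := by
    intro h
    have := hev 0
    rw [h] at this
    simp at this
    linarith
  have hfin : {x : ℝ | (pPoly m).IsRoot x}.Finite := Polynomial.finite_setOfPred_isRoot h0
  have hne : {x : ℝ | (pPoly m).IsRoot x}.Nonempty := by
    have hc : ContinuousOn (fun x : ℝ => (pPoly m).eval x) (Set.Icc 0 1) :=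
      (pPoly m).continuous.continuousOn
    have := intermediate_value_Icc' (zero_le_one' ℝ) hc
    have hz : (0 : ℝ) ∈ Set.Icc ((pPoly m).eval 1) ((pPoly m).eval 0) := by
      rw [hev, hev]
      constructor <;> norm_num <;> linarith
    obtain ⟨x, _, hx⟩ := this hz
    exact ⟨x, hx⟩
  exact ⟨hne.csSup_mem hfin, fun x hx => le_csSup hfin.bddAbove hx⟩

section Decomposition

variable {V : Type*} (G : SimpleGraph V) (u : V)

/-- `A⁺`: the neighbours of `u` that have a neighbour inside `N(u)`. -/
def Aplus : Set V := {v | G.Adj u v ∧ ∃ w, G.Adj u w ∧ G.Adj v w}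

/-- `W`: the vertices outside the closed neighbourhood of `u`. -/
def Wset : Set V := {v | v ≠ u ∧ ¬ G.Adj u v}

/-- `e(W)`: the number of edges of `G[W]`. -/
noncomputable def eW : ℕ := (G.induce (Wset G u)).edgeSet.ncard

/-- `G[A⁺] ≅ K₄`. -/
def AplusIsK4 : Prop := Nonempty (G.induce (Aplus G u) ≃g (⊤ : SimpleGraph (Fin 4)))

/-- `x` is a positive Perron vector of `G`, and its largest entry is attained at `u`. -/
structure IsPerronAt [Fintype V] (x : V → ℝ) : Prop where
  pos : ∀ v, 0 < x v
  eigen : ∀ v, (open Classical in ∑ w with G.Adj v w, x w) = graphRho G * x v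
  max : ∀ v, x v ≤ x u

/-- `G` belongs to the class of `H(4,3)`-free graphs with `m` edges and no isolated vertices. -/
structure IsFishFreeOfSize (m : ℕ) : Prop where
  free : fishGraph.Free G
  size : G.edgeSet.ncard = m
  noIsolated : ∀ v, ∃ w, G.Adj v w

/-- `G` is extremal: it has the largest spectral radius among all `H(4,3)`-free graphs with
`m` edges and no isolated vertices. -/
structure IsExtremal [Fintype V] (m : ℕ) : Prop extends IsFishFreeOfSize G m where
  le : ∀ (n : ℕ) (G' : SimpleGraph (Fin n)), IsFishFreeOfSize G' m → graphRho G' ≤ graphRho G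

/-- The admissible configurations `(G, u)` of the branch `G[A⁺] ≅ K₄`, `e(W) = 1`:
`H(4,3)`-free graphs with `m` edges in which every vertex of `W` has degree at least two. -/
structure IsAdmissible (m : ℕ) : Prop where
  free : fishGraph.Free G
  size : G.edgeSet.ncard = m
  k4 : AplusIsK4 G u
  eW_eq : eW G u = 1
  two_le_deg : ∀ w ∈ Wset G u, 2 ≤ (G.neighborSet w).ncard

end Decomposition

/-- The complete graph on `0, 1, 2, 3, 4` together with the edges listed in `E`. -/
def k5With (n : ℕ) (E : List (ℕ × ℕ)) : SimpleGraph (Fin n) :=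
  SimpleGraph.fromRel fun i j => (i.val < 5 ∧ j.val < 5) ∨ (i.val, j.val) ∈ E

/-- `C` with `l` pendant vertices attached at `r`. -/
def attachLeaves {n : ℕ} (C : SimpleGraph (Fin n)) (r : Fin n) (l : ℕ) :
    SimpleGraph (Fin n ⊕ Fin l) :=
  SimpleGraph.fromRel fun p q =>
    match p, q with
    | Sum.inl i, Sum.inl j => C.Adj i j
    | Sum.inl i, Sum.inr _ => i = r
    | Sum.inr _, _ => False

/-- Same-`A⁰` graph with `l` leaves: `u = 0`, `A⁺ = {1,2,3,4}`, special vertex `z = 5` of `A⁰`,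
`W = {6, 7}`; both ends of the edge `67` are adjacent to `z`. -/
def sameGraph (l : ℕ) : SimpleGraph (Fin 8 ⊕ Fin l) :=
  attachLeaves (k5With 8 [(0, 5), (5, 6), (5, 7), (6, 7)]) 0 l

/-- Distinct-`A⁰` graph with `l` leaves: `u = 0`, `A⁺ = {1,2,3,4}`, special vertices `5, 6` of
`A⁰`, `W = {7, 8}`; the ends `7`, `8` of the edge `78` are adjacent to `5`, `6` respectively. -/
def distinctGraph (l : ℕ) : SimpleGraph (Fin 9 ⊕ Fin l) :=
  attachLeaves (k5With 9 [(0, 5), (0, 6), (5, 7), (6, 8), (7, 8)]) 0 l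

/-- Mixed graph with `l` leaves: `u = 0`, `A⁺ = {1,2,3,4}`, special vertex `5` of `A⁰`,
`W = {6, 7}`; the end `6` of the edge `67` is adjacent to `1 ∈ A⁺`, the end `7` to `5`. -/
def mixedGraph (l : ℕ) : SimpleGraph (Fin 8 ⊕ Fin l) :=
  attachLeaves (k5With 8 [(0, 5), (1, 6), (5, 7), (6, 7)]) 0 l

section Families

variable {V : Type*} (G : SimpleGraph V)

/-- `G` is isomorphic to the member with `m` edges of the same-`A⁰` family. -/
def InSame (m : ℕ) : Prop := ∃ l, m = l + 14 ∧ Nonempty (G ≃g sameGraph l)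

/-- `G` is isomorphic to the member with `m` edges of the distinct-`A⁰` family. -/
def InDistinct (m : ℕ) : Prop := ∃ l, m = l + 15 ∧ Nonempty (G ≃g distinctGraph l)

/-- `G` is isomorphic to the member with `m` edges of the mixed family. -/
def InMixed (m : ℕ) : Prop := ∃ l, m = l + 14 ∧ Nonempty (G ≃g mixedGraph l)

/-- As `InSame`, by an isomorphism that sends `u` to the central vertex; such an isomorphism
respects the decomposition into `u`, `A⁺`, `A⁰` and `W`. -/
def InSameAt (u : V) (m : ℕ) : Prop :=
  ∃ l, m = l + 14 ∧ ∃ e : G ≃g sameGraph l, e u = Sum.inl 0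

/-- As `InDistinct`, by an isomorphism that sends `u` to the central vertex. -/
def InDistinctAt (u : V) (m : ℕ) : Prop :=
  ∃ l, m = l + 15 ∧ ∃ e : G ≃g distinctGraph l, e u = Sum.inl 0

/-- As `InMixed`, by an isomorphism that sends `u` to the central vertex. -/
def InMixedAt (u : V) (m : ℕ) : Prop :=
  ∃ l, m = l + 14 ∧ ∃ e : G ≃g mixedGraph l, e u = Sum.inl 0

/-- The fibres of `c` are the (nonempty) cells of an equitable partition of `G` whose quotient
matrix is `Q`: each vertex of cell `i` has exactly `Q i j` neighbours in cell `j`. -/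
def IsEquitableQuotient {k : ℕ} (c : V → Fin k) (Q : Matrix (Fin k) (Fin k) ℝ) : Prop :=
  Function.Surjective c ∧
    ∀ (v : V) (j : Fin k), (({w | G.Adj v w ∧ c w = j} : Set V).ncard : ℝ) = Q (c v) j

end Families

/-- The partition `{u}, A⁺, {z}, {x, y}, L` of the same-`A⁰` graph. -/
def sameCell (l : ℕ) : Fin 8 ⊕ Fin l → Fin 5 :=
  Sum.elim ![0, 1, 1, 1, 1, 2, 3, 3] fun _ => 4

/-- The partition `{u}, A⁺, {z₁, z₂}, {x, y}, L` of the distinct-`A⁰` graph. -/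
def distinctCell (l : ℕ) : Fin 9 ⊕ Fin l → Fin 5 :=
  Sum.elim ![0, 1, 1, 1, 1, 2, 2, 3, 3] fun _ => 4

/-- The partition `{u}, {a}, A⁺ \ {a}, {z}, {x}, {y}, L` of the mixed graph. -/
def mixedCell (l : ℕ) : Fin 8 ⊕ Fin l → Fin 7 :=
  Sum.elim ![0, 1, 2, 2, 2, 3, 4, 5] fun _ => 6

def sameQuotient (m : ℝ) : Matrix (Fin 5) (Fin 5) ℝ :=
  !![0, 4, 1, 0, m - 14;
     1, 3, 0, 0, 0;
     1, 0, 0, 2, 0;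
     0, 0, 1, 1, 0;
     1, 0, 0, 0, 0]

def distinctQuotient (m : ℝ) : Matrix (Fin 5) (Fin 5) ℝ :=
  !![0, 4, 2, 0, m - 15;
     1, 3, 0, 0, 0;
     1, 0, 0, 1, 0;
     0, 0, 1, 1, 0;
     1, 0, 0, 0, 0]

def mixedQuotient (m : ℝ) : Matrix (Fin 7) (Fin 7) ℝ :=
  !![0, 1, 3, 1, 0, 0, m - 14;
     1, 0, 3, 0, 1, 0, 0;
     1, 1, 2, 0, 0, 0, 0;
     1, 0, 0, 0, 0, 1, 0;
     0, 1, 0, 0, 0, 1, 0;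
     0, 0, 0, 1, 1, 0, 0;
     1, 0, 0, 0, 0, 0, 0]

noncomputable def fSame (m : ℝ) : ℝ[X] :=
  X ^ 5 - 4 * X ^ 4 + C (10 - m) * X ^ 3 + C (4 * m - 42) * X ^ 2 + C (19 - m) * X
    + C (84 - 6 * m)

noncomputable def fDistinct (m : ℝ) : ℝ[X] :=
  X ^ 5 - 4 * X ^ 4 + C (11 - m) * X ^ 3 + C (4 * m - 45) * X ^ 2 + C (28 - 2 * m) * X
    + C (45 - 3 * m)

noncomputable def fMixed (m : ℝ) : ℝ[X] :=
  X ^ 7 - 2 * X ^ 6 + C (3 - m) * X ^ 5 + C (2 * m - 24) * X ^ 4 + C (6 * m - 61) * X ^ 3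
    + C (84 - 6 * m) * X ^ 2 + C (90 - 7 * m) * X + C (2 * m - 28)

/-! ### Spectral radius: eigenvectors, supersolutions, Rayleigh quotients -/

section SpectralRadius

variable {V : Type*} [Fintype V]

/-! Degree condition. If `w ∈ W` were a leaf at `v`, reattach it to `u`. This creates no fish and
keeps the number of edges, and since `x u ≥ x v` the Rayleigh quotient of the Perron vector does not
drop. If the spectral radius did not grow, `x` would still be an eigenvector, which fails at `u`
(`graphRho_lt_graphRho_moveLeaf`). If `v` has no other neighbour, a `K₂` component forces `ρ = 1`,
which the star with `m` edges beats.

Classification. Since `A⁺` is a `K₄`, a vertex of `W` with two neighbours in `N` closes a 4-cycle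
through `u`, and two further vertices of `A⁺` give a triangle at `u`: a fish. So every vertex of `W`
has at most one neighbour in `N`, and minimum degree two leaves only the ends of the single edge of
`G[W]`, each with exactly one neighbour in `N` (`IsAdmissible.exists_isCore`). These two neighbours
are not both in `A⁺` (`IsCore.not_both_mem_range`), and the remaining possibilities are the three
families.

Comparison. Choose `c` with `c² - c + 3/2 = m`. Then `p_m(c) = -1/4 < 0`, so `c < ρ'(m)`, while each
family carries an explicit positive vector with `A x ≤ c x`, so its spectral radius is at most `c`.
The quotient polynomials are not needed for this. -/

open Classical in
theorem mem_spectrum_adjMatrix_iff (G : SimpleGraph V) (k : ℝ) :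
    k ∈ spectrum ℝ (G.adjMatrix ℝ) ↔
      ∃ y : V → ℝ, y ≠ 0 ∧ ∀ v, ∑ w with G.Adj v w, y w = k * y v := by
  rw [spectrum.mem_iff, Matrix.isUnit_iff_isUnit_det, isUnit_iff_ne_zero, not_not,
    ← Matrix.exists_mulVec_eq_zero_iff]
  refine exists_congr fun y => and_congr_right fun _ => ?_
  rw [funext_iff]
  refine forall_congr' fun v => ?_
  rw [Matrix.sub_mulVec, Pi.sub_apply, SimpleGraph.adjMatrix_mulVec_apply,
    Algebra.algebraMap_eq_smul_one, Matrix.smul_mulVec, Matrix.one_mulVec, Pi.smul_apply,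
    smul_eq_mul, Pi.zero_apply, sub_eq_zero, eq_comm, SimpleGraph.neighborFinset_eq_filter]

open Classical in
theorem abs_le_graphRho (G : SimpleGraph V) {k : ℝ} (hk : k ∈ spectrum ℝ (G.adjMatrix ℝ)) :
    |k| ≤ graphRho G := by
  have hfin : (spectrum ℝ (G.adjMatrix ℝ)).Finite := Matrix.finite_real_spectrum
  obtain ⟨c, hc⟩ := (hfin.image fun k => |k|).bddAbove
  -- `toReal` sends `⊤` to `0`, so the supremum must be known to be finite; this follows from the
  -- finiteness of the spectrum.
  have htop : spectralRadius ℝ (G.adjMatrix ℝ) ≠ ⊤ := by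
    refine ne_top_of_le_ne_top (ENNReal.ofReal_ne_top (r := c)) (iSup₂_le fun k hk => ?_)
    rw [← enorm_eq_nnnorm, ← ofReal_norm]
    exact ENNReal.ofReal_le_ofReal (hc ⟨k, hk, rfl⟩)
  have h : (‖k‖₊ : ENNReal) ≤ spectralRadius ℝ (G.adjMatrix ℝ) :=
    le_iSup₂ (f := fun (k : ℝ) (_ : k ∈ spectrum ℝ (G.adjMatrix ℝ)) => (‖k‖₊ : ENNReal)) k hk
  simpa [graphRho] using ENNReal.toReal_mono htop h

open Classical in
theorem graphRho_le (G : SimpleGraph V) {c : ℝ} (hc : 0 ≤ c)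
    (h : ∀ k ∈ spectrum ℝ (G.adjMatrix ℝ), |k| ≤ c) : graphRho G ≤ c := by
  refine ENNReal.toReal_le_of_le_ofReal hc (iSup₂_le fun k hk => ?_)
  rw [← enorm_eq_nnnorm, ← ofReal_norm]
  exact ENNReal.ofReal_le_ofReal (h k hk)

open Classical in
/-- A positive vector `x` with `A x ≤ c x` bounds the spectral radius by `c`. -/
theorem graphRho_le_of_supersolution (G : SimpleGraph V) {c : ℝ} (hc : 0 ≤ c) (x : V → ℝ)
    (hx : ∀ v, 0 < x v) (h : ∀ v, ∑ w with G.Adj v w, x w ≤ c * x v) : graphRho G ≤ c := by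
  refine graphRho_le G hc fun k hk => ?_
  obtain ⟨y, hy0, hy⟩ := (mem_spectrum_adjMatrix_iff G k).1 hk
  obtain ⟨v₀, hv₀⟩ := Function.ne_iff.1 hy0
  have : Nonempty V := ⟨v₀⟩
  -- Maximum principle: compare the eigenvector `y` with `x` at a vertex where `|y| / x` is largest.
  obtain ⟨v, hv⟩ := Finite.exists_max fun v => |y v| / x v
  have hle : ∀ w, |y w| ≤ |y v| / x v * x w := fun w => by
    rw [← div_le_iff₀ (hx w)]; exact hv w
  have hpos : 0 < |y v| := by
    have h1 := (div_pos (abs_pos.2 hv₀) (hx v₀)).trans_le (hv v₀)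
    exact (div_pos_iff_of_pos_right (hx v)).1 h1
  have h2 : |k| * |y v| ≤ c * |y v| := calc
    |k| * |y v| = |∑ w with G.Adj v w, y w| := by rw [hy v, abs_mul]
    _ ≤ ∑ w with G.Adj v w, |y w| := Finset.abs_sum_le_sum_abs _ _
    _ ≤ ∑ w with G.Adj v w, |y v| / x v * x w := Finset.sum_le_sum fun w _ => hle w
    _ = |y v| / x v * ∑ w with G.Adj v w, x w := by rw [Finset.mul_sum]
    _ ≤ |y v| / x v * (c * x v) :=
        mul_le_mul_of_nonneg_left (h v) (div_nonneg (abs_nonneg _) (hx v).le)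
    _ = c * |y v| := by field_simp [(hx v).ne']
  exact le_of_mul_le_mul_right h2 hpos

-- The spectrum of `ρ I - A` is `ρ` minus that of `A`, hence nonnegative. This replaces a
-- variational characterisation of `ρ`.
open Classical in
theorem posSemidef_graphRho_sub_adjMatrix (G : SimpleGraph V) :
    (graphRho G • (1 : Matrix V V ℝ) - G.adjMatrix ℝ).PosSemidef := by
  have hM : (graphRho G • (1 : Matrix V V ℝ) - G.adjMatrix ℝ).IsHermitian := by
    refine Matrix.IsHermitian.sub ?_ ?_
    · simp [Matrix.IsHermitian]
    · simp [Matrix.IsHermitian, Matrix.conjTranspose_eq_transpose_of_trivial]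
  rw [hM.posSemidef_iff_eigenvalues_nonneg]
  intro i
  have hi : hM.eigenvalues i ∈ spectrum ℝ (algebraMap ℝ _ (graphRho G) - G.adjMatrix ℝ) := by
    rw [Algebra.algebraMap_eq_smul_one]
    exact hM.eigenvalues_mem_spectrum_real i
  rw [← spectrum.singleton_sub_eq] at hi
  obtain ⟨a, ha, k, hk, hak⟩ := hi
  have hle := le_of_abs_le (abs_le_graphRho G hk)
  rw [← hak, Set.mem_singleton_iff.1 ha]
  exact sub_nonneg.2 hle

open Classical in
/-- A vector whose Rayleigh quotient is at least the spectral radius is an eigenvector. -/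
theorem eigen_of_graphRho_mul_le (G : SimpleGraph V) (y : V → ℝ)
    (h : graphRho G * ∑ v, y v ^ 2 ≤ ∑ v, y v * ∑ w with G.Adj v w, y w) (v : V) :
    ∑ w with G.Adj v w, y w = graphRho G * y v := by
  have hpsd := posSemidef_graphRho_sub_adjMatrix G
  have hmul : ∀ v, ((graphRho G • (1 : Matrix V V ℝ) - G.adjMatrix ℝ).mulVec y) v
      = graphRho G * y v - ∑ w with G.Adj v w, y w := fun v => by
    rw [Matrix.sub_mulVec, Matrix.smul_mulVec, Matrix.one_mulVec, Pi.sub_apply,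
      SimpleGraph.adjMatrix_mulVec_apply, SimpleGraph.neighborFinset_eq_filter,
      Pi.smul_apply, smul_eq_mul]
  have hq : star y ⬝ᵥ (graphRho G • (1 : Matrix V V ℝ) - G.adjMatrix ℝ).mulVec y
      = graphRho G * ∑ v, y v ^ 2 - ∑ v, y v * ∑ w with G.Adj v w, y w := by
    simp only [dotProduct, hmul, star_trivial, mul_sub, Finset.sum_sub_distrib, Finset.mul_sum]
    congr 1
    exact Finset.sum_congr rfl fun v _ => by ring
  -- The form is nonnegative, and `h` makes it nonpositive; a vector on which a positive
  -- semidefinite form vanishes lies in the kernel.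
  have h0 : star y ⬝ᵥ (graphRho G • (1 : Matrix V V ℝ) - G.adjMatrix ℝ).mulVec y = 0 :=
    le_antisymm (by rw [hq]; linarith) (hpsd.dotProduct_mulVec_nonneg y)
  have hz := congrFun ((hpsd.dotProduct_mulVec_zero_iff y).1 h0) v
  rw [hmul, Pi.zero_apply] at hz
  linarith

open Classical in
theorem graphRho_congr {V' : Type*} [Fintype V'] {G : SimpleGraph V} {G' : SimpleGraph V'}
    (e : G ≃g G') : graphRho G = graphRho G' := by
  have : (Matrix.reindexAlgEquiv ℝ ℝ e.toEquiv) (G.adjMatrix ℝ) = G'.adjMatrix ℝ := by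
    ext i j
    have : G.Adj (e.symm i) (e.symm j) ↔ G'.Adj i j := e.symm.map_adj_iff
    simp only [Matrix.coe_reindexAlgEquiv, Matrix.reindex_apply, Matrix.submatrix_apply,
      SimpleGraph.adjMatrix_apply]
    exact if_congr this rfl rfl
  simp only [graphRho, spectralRadius]
  rw [← this, AlgEquiv.spectrum_eq]

end SpectralRadius

/-! ### The fish graph -/

section Fish

variable {V : Type*} {G : SimpleGraph V}

/-- Ensures that a copy of the fish never uses a leaf of the host graph. -/
theorem exists_two_adj_fishGraph (i : Fin 6) :
    ∃ j k, j ≠ k ∧ fishGraph.Adj i j ∧ fishGraph.Adj i k := by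
  refine ⟨![1, 0, 1, 0, 0, 0] i, ![3, 2, 3, 2, 5, 4] i, ?_⟩
  fin_cases i <;> simp [fishGraph]

/-- A fish-free graph has no 4-cycle `a b c d` and triangle `a e f` that only share `a`. -/
theorem SimpleGraph.Free.not_fish (h : fishGraph.Free G) {a b c d e f : V}
    (hab : G.Adj a b) (hbc : G.Adj b c) (hcd : G.Adj c d) (hda : G.Adj d a)
    (hae : G.Adj a e) (hef : G.Adj e f) (hfa : G.Adj f a)
    (hac : a ≠ c) (hbd : b ≠ d) (hbe : b ≠ e) (hbf : b ≠ f) (hce : c ≠ e) (hcf : c ≠ f)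
    (hde : d ≠ e) (hdf : d ≠ f) : False := by
  refine h ⟨⟨⟨![a, b, c, d, e, f], ?_⟩, ?_⟩⟩
  · intro i j hij
    simp only [fishGraph, SimpleGraph.fromRel_adj] at hij
    have := hab.symm; have := hbc.symm; have := hcd.symm; have := hda.symm
    have := hae.symm; have := hef.symm; have := hfa.symm
    fin_cases i <;> fin_cases j <;> first | assumption | (exfalso; revert hij; decide)
  · intro i j hij
    have := hab.ne; have := hbc.ne; have := hcd.ne; have := hda.ne
    have := hae.ne; have := hef.ne; have := hfa.ne
    fin_cases i <;> fin_cases j <;> first | rfl | (exfalso; simp_all)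

end Fish

/-! ### Extremal graphs: moving a leaf to the maximal Perron entry -/

section Extremal

variable {V : Type*} {G : SimpleGraph V} {m : ℕ}

theorem IsFishFreeOfSize.congr {V' : Type*} {G' : SimpleGraph V'} (h : IsFishFreeOfSize G m)
    (e : G ≃g G') : IsFishFreeOfSize G' m where
  free := (SimpleGraph.free_congr SimpleGraph.Iso.refl e).1 h.free
  size := by
    rw [← h.size]
    exact (Nat.card_congr e.mapEdgeSet).symm
  noIsolated v := by
    obtain ⟨w, hw⟩ := h.noIsolated (e.symm v)
    exact ⟨e w, by simpa using e.map_adj_iff.2 hw⟩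

/-- The star with `m` edges. -/
def starOfSize (m : ℕ) : SimpleGraph (Fin (m + 1)) :=
  SimpleGraph.fromRel fun i _ => i = 0

theorem isFishFreeOfSize_starOfSize (hm : m ≠ 0) : IsFishFreeOfSize (starOfSize m) m where
  free := by
    rintro ⟨f⟩
    have key : ∀ i j, fishGraph.Adj i j → f i = 0 ∨ f j = 0 := fun i j hij => by
      have := f.toHom.map_adj hij
      exact (SimpleGraph.fromRel_adj _ _ _).1 this |>.2
    -- The fish has two disjoint edges, whereas all edges of a star meet in its centre.
    have h1 := key 1 2 (by simp [fishGraph])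
    have h2 := key 4 5 (by simp [fishGraph])
    have hne : ∀ i j, i ≠ j → f i = 0 → f j = 0 → False :=
      fun i j hij hi hj => hij (f.injective (hi.trans hj.symm))
    rcases h1 with h1 | h1 <;> rcases h2 with h2 | h2
    all_goals exact hne _ _ (by decide) h1 h2
  size := by
    have : (starOfSize m).edgeSet = Set.range fun i : Fin m => s(0, i.succ) := by
      ext p
      induction p using Sym2.ind with
      | _ a b =>
        simp only [SimpleGraph.mem_edgeSet, starOfSize, SimpleGraph.fromRel_adj, Set.mem_range]
        constructor
        · rintro ⟨hab, rfl | rfl⟩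
          · obtain ⟨i, rfl⟩ := Fin.exists_succ_eq.2 hab.symm
            exact ⟨i, rfl⟩
          · obtain ⟨i, rfl⟩ := Fin.exists_succ_eq.2 hab
            exact ⟨i, Sym2.eq_swap⟩
        · rintro ⟨i, hi⟩
          rcases Sym2.eq_iff.1 hi with ⟨rfl, rfl⟩ | ⟨rfl, rfl⟩
          · exact ⟨(Fin.succ_ne_zero i).symm, Or.inl rfl⟩
          · exact ⟨Fin.succ_ne_zero i, Or.inr rfl⟩
    rw [this, ← Set.image_univ, Set.ncard_image_of_injective, Set.ncard_univ, Nat.card_fin]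
    intro i j hij
    simpa using hij
  noIsolated v := by
    rcases eq_or_ne v 0 with rfl | hv
    · refine ⟨Fin.last m, ?_⟩
      simp only [starOfSize, SimpleGraph.fromRel_adj, true_or, and_true]
      intro h
      exact hm (by simpa using (congrArg Fin.val h).symm)
    · exact ⟨0, by simp [starOfSize, hv]⟩

/-- The eigenvector is `√m` at the centre and `1` at the leaves. -/
theorem sqrt_le_graphRho_starOfSize (hm : m ≠ 0) : √m ≤ graphRho (starOfSize m) := by
  classical
  refine (le_abs_self _).trans (abs_le_graphRho _ ((mem_spectrum_adjMatrix_iff _ _).2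
    ⟨Fin.cons √m fun _ => 1, fun h => ?_, fun v => ?_⟩))
  · have := congrFun h 0
    simp [hm] at this
  · rw [Finset.sum_filter, Fin.sum_univ_succ]
    refine Fin.cases ?_ (fun i => ?_) v
    · simp [starOfSize, (Fin.succ_ne_zero _).symm]
    · simp [starOfSize, Fin.succ_ne_zero]

/-- Reattaching the pendant vertex `w` from `v` to `u`. -/
def moveLeaf (G : SimpleGraph V) (u v w : V) : SimpleGraph V :=
  G.deleteEdges {s(v, w)} ⊔ SimpleGraph.edge u w

variable {u v w : V}

theorem moveLeaf_adj (hwu : w ≠ u) {p q : V} : (moveLeaf G u v w).Adj p q ↔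
    (G.Adj p q ∧ s(p, q) ≠ s(v, w)) ∨ s(p, q) = s(u, w) := by
  rw [moveLeaf, SimpleGraph.sup_adj, SimpleGraph.deleteEdges_adj, Set.mem_singleton_iff,
    SimpleGraph.edge_adj, Sym2.eq_iff (x := p) (z := u)]
  constructor
  · rintro (h | h)
    · exact Or.inl h
    · exact Or.inr h.1
  · rintro (h | h)
    · exact Or.inl h
    · refine Or.inr ⟨h, ?_⟩
      rintro rfl
      rcases h with ⟨rfl, h⟩ | ⟨rfl, h⟩ <;> simp_all

theorem moveLeaf_adj_right_iff (hwu : w ≠ u) (hw : ∀ q, G.Adj w q ↔ q = v) {q : V} :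
    (moveLeaf G u v w).Adj w q ↔ q = u := by
  rw [moveLeaf_adj hwu, hw]
  simp only [Sym2.eq_iff, ne_eq]
  grind

theorem moveLeaf_adj_of_ne (hwu : w ≠ u) {p q : V} (hp : p ≠ w) (hq : q ≠ w) :
    (moveLeaf G u v w).Adj p q ↔ G.Adj p q := by
  rw [moveLeaf_adj hwu]
  simp only [Sym2.eq_iff, ne_eq]
  grind

/-- The vertex `w` is still a leaf after the move, so a fish avoids it and would already lie in `G`.
The hypothesis `hv` keeps `v` from becoming isolated. -/
theorem isFishFreeOfSize_moveLeaf (h : IsFishFreeOfSize G m) (hwu : w ≠ u) (huw : ¬ G.Adj u w)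
    (hw : ∀ q, G.Adj w q ↔ q = v) (hv : ∃ q, q ≠ w ∧ G.Adj v q) :
    IsFishFreeOfSize (moveLeaf G u v w) m where
  free := by
    rintro ⟨f⟩
    have hf : ∀ i, f i ≠ w := fun i hi => by
      obtain ⟨j, k, hjk, hj, hk⟩ := exists_two_adj_fishGraph i
      have h1 := f.toHom.map_adj hj
      have h2 := f.toHom.map_adj hk
      change (moveLeaf G u v w).Adj (f i) (f j) at h1
      change (moveLeaf G u v w).Adj (f i) (f k) at h2
      rw [hi, moveLeaf_adj_right_iff hwu hw] at h1 h2
      exact hjk (f.injective (h1.trans h2.symm))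
    exact h.free ⟨⟨⟨f, fun {i j} hij =>
      (moveLeaf_adj_of_ne hwu (hf i) (hf j)).1 (f.toHom.map_adj hij)⟩, f.injective⟩⟩
  size := by
    have hE : (moveLeaf G u v w).edgeSet = insert s(u, w) (G.edgeSet \ {s(v, w)}) := by
      ext p
      induction p using Sym2.ind with
      | _ a b =>
        rw [SimpleGraph.mem_edgeSet, moveLeaf_adj hwu]
        simp [or_comm]
    rw [hE, Set.ncard_exchange (by simpa using huw) (by simpa using ((hw v).2 rfl).symm), h.size]
  noIsolated p := by
    rcases eq_or_ne p w with rfl | hp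
    · exact ⟨u, (moveLeaf_adj_right_iff hwu hw).2 rfl⟩
    · have : ∃ q, q ≠ w ∧ G.Adj p q := by
        obtain ⟨q, hq⟩ := h.noIsolated p
        by_cases hqw : q = w
        · rw [hqw] at hq
          rwa [(hw p).1 hq.symm]
        · exact ⟨q, hqw, hq⟩
      obtain ⟨q, hqw, hq⟩ := this
      exact ⟨q, (moveLeaf_adj_of_ne hwu hp hqw).2 hq⟩

variable [Fintype V]

theorem IsExtremal.graphRho_le {V' : Type*} [Fintype V'] {G' : SimpleGraph V'}
    (h : IsExtremal G m) (h' : IsFishFreeOfSize G' m) : graphRho G' ≤ graphRho G := by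
  rw [graphRho_congr (G'.overFinIso rfl)]
  exact h.le _ _ (h'.congr (G'.overFinIso rfl))

open Classical in
theorem sum_adj_eq_of_forall_adj_iff (hw : ∀ q, G.Adj w q ↔ q = v) (x : V → ℝ) :
    ∑ q with G.Adj w q, x q = x v := by
  have : (Finset.univ.filter fun q => G.Adj w q) = {v} := by ext q; simp [hw]
  rw [this, Finset.sum_singleton]

-- The move changes the quadratic form at `x` by `2 x_w (x_u - x_v) ≥ 0`. Without strict growth `x`
-- would be an eigenvector of the new graph, but its neighbour sum at `u` has gained `x_w > 0`.
open Classical in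
theorem graphRho_lt_graphRho_moveLeaf {x : V → ℝ} (hx : IsPerronAt G u x) (hwu : w ≠ u)
    (huw : ¬ G.Adj u w) (hw : ∀ q, G.Adj w q ↔ q = v) :
    graphRho G < graphRho (moveLeaf G u v w) := by
  by_contra! hle
  have hvw : G.Adj v w := ((hw v).2 rfl).symm
  have huv : u ≠ v := fun h => huw (h ▸ hvw)
  have hS : ∀ p, ∑ q with (moveLeaf G u v w).Adj p q, x q = ∑ q with G.Adj p q, x q
      + ((if p = u then x w else 0) - (if p = v then x w else 0)
        + if p = w then x u - x v else 0) := by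
    intro p
    by_cases hpw : p = w
    · subst hpw
      rw [sum_adj_eq_of_forall_adj_iff (fun q => moveLeaf_adj_right_iff hwu hw),
        sum_adj_eq_of_forall_adj_iff hw]
      simp [hwu, hvw.ne']
    by_cases hpu : p = u
    · subst hpu
      have : (Finset.univ.filter fun q => (moveLeaf G p v w).Adj p q)
          = insert w (Finset.univ.filter fun q => G.Adj p q) := by
        ext q
        by_cases hq : q = w
        · simp [hq, moveLeaf_adj hwu]
        · simp [hq, moveLeaf_adj_of_ne hwu hpw hq]
      rw [this, Finset.sum_insert (by simpa using huw)]
      simp [huv, hpw, add_comm]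
    by_cases hpv : p = v
    · subst hpv
      have : (Finset.univ.filter fun q => G.Adj p q)
          = insert w (Finset.univ.filter fun q => (moveLeaf G u p w).Adj p q) := by
        ext q
        by_cases hq : q = w
        · simp [hq, hvw]
        · simp [hq, moveLeaf_adj_of_ne hwu hpw hq]
      rw [this, Finset.sum_insert (by simp [moveLeaf_adj hwu, huv.symm, hpw])]
      simp [huv.symm, hpw]
    · have : (Finset.univ.filter fun q => (moveLeaf G u v w).Adj p q)
          = (Finset.univ.filter fun q => G.Adj p q) := by
        ext q
        by_cases hq : q = w
        · have : ¬ G.Adj p w := fun h => hpv ((hw p).1 h.symm)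
          simp [hq, moveLeaf_adj hwu, this, hpu, hpw]
        · simp [moveLeaf_adj_of_ne hwu hpw hq]
      rw [this]
      simp [hpw, hpu, hpv]
  have hsum : ∑ p, x p * ∑ q with (moveLeaf G u v w).Adj p q, x q
      = graphRho G * ∑ p, x p ^ 2 + 2 * (x w * (x u - x v)) := by
    simp only [hS, hx.eigen, mul_add, mul_sub, Finset.sum_add_distrib, Finset.sum_sub_distrib,
      Finset.mul_sum, mul_ite, mul_zero, Finset.sum_ite_eq', Finset.mem_univ, if_true]
    have : ∑ p, x p * (graphRho G * x p) = ∑ p, graphRho G * x p ^ 2 :=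
      Finset.sum_congr rfl fun p _ => by ring
    rw [this]
    ring
  have hge : graphRho (moveLeaf G u v w) * ∑ p, x p ^ 2
      ≤ ∑ p, x p * ∑ q with (moveLeaf G u v w).Adj p q, x q := by
    rw [hsum]
    have h1 := mul_le_mul_of_nonneg_right hle (Finset.sum_nonneg fun p (_ : p ∈ Finset.univ) =>
      sq_nonneg (x p))
    have h2 := mul_nonneg (hx.pos w).le (sub_nonneg.2 (hx.max v))
    linarith
  have hu := eigen_of_graphRho_mul_le _ x hge u
  rw [hS, hx.eigen] at hu
  have h3 := mul_le_mul_of_nonneg_right hle (hx.pos u).le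
  have h4 := hx.pos w
  simp [huv, hwu.symm] at hu
  linarith

theorem two_le_degree_of_isExtremal (hm : Even m) {x : V → ℝ} (hG : IsExtremal G m)
    (hx : IsPerronAt G u x) (hwW : w ∈ Wset G u) : 2 ≤ (G.neighborSet w).ncard := by
  classical
  by_contra! hlt
  obtain ⟨hwu, huw⟩ := hwW
  obtain ⟨v, hv⟩ := hG.noIsolated w
  have hw : ∀ q, G.Adj w q ↔ q = v := fun q =>
    ⟨fun hq => (Set.ncard_le_one_iff (Set.toFinite _)).1 (Nat.lt_succ_iff.1 hlt) hq hv, fun hq => hq ▸ hv⟩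
  by_cases hv2 : ∃ q, q ≠ w ∧ G.Adj v q
  · exact (graphRho_lt_graphRho_moveLeaf hx hwu huw hw).not_ge
      (hG.graphRho_le (isFishFreeOfSize_moveLeaf hG.toIsFishFreeOfSize hwu huw hw hv2))
  -- Here `{v, w}` is a `K₂` component, and positivity of the Perron vector gives `ρ² = 1`.
  · push Not at hv2
    have hv3 : ∀ q, G.Adj v q ↔ q = w := fun q =>
      ⟨fun hq => by_contra fun hqw => hv2 q hqw hq, fun hq => hq ▸ hv.symm⟩
    have e1 := hx.eigen w
    have e2 := hx.eigen v
    rw [sum_adj_eq_of_forall_adj_iff hw] at e1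
    rw [sum_adj_eq_of_forall_adj_iff hv3] at e2
    have hone : graphRho G ^ 2 = 1 := by
      rw [e1] at e2
      have h0 := (hx.pos w).ne'
      apply mul_right_cancel₀ h0
      linarith
    have hm0 : m ≠ 0 := by
      rintro rfl
      have := (Set.ncard_eq_zero (Set.toFinite _)).1 hG.size
      have h2 : s(w, v) ∈ G.edgeSet := hv
      rw [this] at h2
      exact h2
    -- Evenness excludes `m = 1`, for which the star would only give `ρ ≥ 1`.
    have hm2 : (2 : ℝ) ≤ m := by
      have : 2 ≤ m := by obtain ⟨k, rfl⟩ := hm; omega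
      exact_mod_cast this
    have h1 := (sqrt_le_graphRho_starOfSize hm0).trans
      (hG.graphRho_le (isFishFreeOfSize_starOfSize hm0))
    have h2 := pow_le_pow_left₀ (Real.sqrt_nonneg _) h1 2
    rw [Real.sq_sqrt (by positivity), hone] at h2
    linarith

end Extremal

/-! ### Characteristic polynomials of the quotient matrices -/

section CharacteristicPolynomials

theorem charpoly_sameQuotient (m : ℝ) : (sameQuotient m).charpoly = fSame m := by
  refine Polynomial.funext fun t => ?_
  rw [Matrix.eval_charpoly]
  simp [fSame, sameQuotient, Matrix.det_succ_row_zero, Fin.sum_univ_succ, Fin.succAbove,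
    Matrix.submatrix, Matrix.scalar_apply]
  ring

theorem charpoly_distinctQuotient (m : ℝ) : (distinctQuotient m).charpoly = fDistinct m := by
  refine Polynomial.funext fun t => ?_
  rw [Matrix.eval_charpoly]
  simp [fDistinct, distinctQuotient, Matrix.det_succ_row_zero, Fin.sum_univ_succ, Fin.succAbove,
    Matrix.submatrix, Matrix.scalar_apply]
  ring

/-- The characteristic matrix of `mixedQuotient`, with the cells in reverse order. -/
theorem scalar_sub_mixedQuotient_submatrix (m t : ℝ) :
    (Matrix.scalar (Fin 7) t - mixedQuotient m).submatrix Fin.revPerm Fin.revPerm =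
    !![t, 0, 0, 0, 0, 0, -1;
       0, t, -1, -1, 0, 0, 0;
       0, -1, t, 0, 0, -1, 0;
       0, -1, 0, t, 0, 0, -1;
       0, 0, 0, 0, t - 2, -1, -1;
       0, 0, -1, 0, -3, t, -1;
       14 - m, 0, 0, -1, -3, -1, t] := by
  ext i j
  fin_cases i <;> fin_cases j <;> simp [mixedQuotient, Fin.rev]

set_option maxHeartbeats 1000000 in
theorem charpoly_mixedQuotient (m : ℝ) : (mixedQuotient m).charpoly = fMixed m := by
  refine Polynomial.funext fun t => ?_
  -- Reversing the cells puts the sparse rows first, which keeps the expansion along the top row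
  -- small.
  rw [Matrix.eval_charpoly, ← Matrix.det_submatrix_equiv_self Fin.revPerm,
    scalar_sub_mixedQuotient_submatrix]
  simp [Matrix.det_succ_row_zero, Fin.sum_univ_succ, Fin.succAbove]
  simp [fMixed]
  ring

end CharacteristicPolynomials

/-! ### Neighbour counts in a core with leaves attached -/

section Leaves

instance decidableRelK5WithAdj (n : ℕ) (E : List (ℕ × ℕ)) : DecidableRel (k5With n E).Adj :=
  fun i j => decidable_of_iff (i ≠ j ∧ (((i.val < 5 ∧ j.val < 5) ∨ (i.val, j.val) ∈ E) ∨
    ((j.val < 5 ∧ i.val < 5) ∨ (j.val, i.val) ∈ E))) Iff.rfl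

variable {n : ℕ} {C : SimpleGraph (Fin n)} {r : Fin n} {l : ℕ}

@[simp]
theorem attachLeaves_adj_inl_inl {i j : Fin n} :
    (attachLeaves C r l).Adj (Sum.inl i) (Sum.inl j) ↔ C.Adj i j := by
  simp only [attachLeaves, SimpleGraph.fromRel_adj, C.adj_comm j i, or_self, ne_eq,
    Sum.inl.injEq, and_iff_right_iff_imp]
  exact fun h => h.ne

@[simp]
theorem attachLeaves_adj_inl_inr {i : Fin n} {j : Fin l} :
    (attachLeaves C r l).Adj (Sum.inl i) (Sum.inr j) ↔ i = r := by
  simp [attachLeaves]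

@[simp]
theorem attachLeaves_adj_inr_inl {i : Fin n} {j : Fin l} :
    (attachLeaves C r l).Adj (Sum.inr j) (Sum.inl i) ↔ i = r := by
  simp [attachLeaves]

@[simp]
theorem not_attachLeaves_adj_inr_inr {i j : Fin l} :
    ¬ (attachLeaves C r l).Adj (Sum.inr i) (Sum.inr j) := by
  simp [attachLeaves]

/-- Separates a count in the fixed core, which `decide` can evaluate, from the contribution of the
`l` leaves. -/
theorem ncard_attachLeaves_inl [DecidableRel C.Adj] {k : ℕ} (c : Fin n → Fin k) (a j : Fin k)
    (i : Fin n) :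
    {w | (attachLeaves C r l).Adj (Sum.inl i) w ∧ Sum.elim c (fun _ => a) w = j}.ncard
      = (Finset.univ.filter fun w => C.Adj i w ∧ c w = j).card
        + if i = r ∧ a = j then l else 0 := by
  classical
  have : {w | (attachLeaves C r l).Adj (Sum.inl i) w ∧ Sum.elim c (fun _ => a) w = j}
      = ((Finset.univ.filter fun w => C.Adj i w ∧ c w = j).disjSum
          (Finset.univ.filter fun _ : Fin l => i = r ∧ a = j) : Finset _) := by
    ext (w | w)
    · simp
    · simp [-Finset.filter_const]
  rw [this, Set.ncard_coe_finset, Finset.card_disjSum]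
  split_ifs with h <;> simp [h]

theorem ncard_attachLeaves_inr {k : ℕ} (c : Fin n → Fin k) (a j : Fin k) (i : Fin l) :
    {w | (attachLeaves C r l).Adj (Sum.inr i) w ∧ Sum.elim c (fun _ => a) w = j}.ncard
      = if c r = j then 1 else 0 := by
  split_ifs with h
  · rw [Set.ncard_eq_one]
    refine ⟨Sum.inl r, ?_⟩
    ext (w | w)
    · simp only [Set.mem_ofPred_eq, attachLeaves_adj_inr_inl, Sum.elim_inl, Set.mem_singleton_iff,
        Sum.inl.injEq, and_iff_left_iff_imp]
      rintro rfl; exact h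
    · simp
  · rw [Set.ncard_eq_zero (Set.toFinite _)]
    ext (w | w)
    · simp only [Set.mem_ofPred_eq, attachLeaves_adj_inr_inl, Sum.elim_inl,
        Set.mem_empty_iff_false, iff_false, not_and]
      rintro rfl; exact h
    · simp

end Leaves

/-! ### Equitable partitions of the three families -/

section Equitable

variable {n : ℕ} {C : SimpleGraph (Fin n)} {r : Fin n} {l : ℕ}

/-- An equitable partition of the core in which `r` is a cell extends to the graph with leaves. -/
theorem isEquitableQuotient_attachLeaves [DecidableRel C.Adj] {k : ℕ} {c : Fin n → Fin k}
    {a : Fin k} {Q : Matrix (Fin k) (Fin k) ℝ} (N : Matrix (Fin k) (Fin k) ℕ) (hl : l ≠ 0)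
    (hN : ∀ i j, (Finset.univ.filter fun w => C.Adj i w ∧ c w = j).card = N (c i) j)
    (hr : ∀ i, c i = c r → i = r) (hs : ∀ j, j ≠ a → ∃ i, c i = j)
    (hQ : ∀ i j, i ≠ a → Q i j = N i j + if i = c r ∧ a = j then (l : ℝ) else 0)
    (ha : ∀ i, c i ≠ a) (hQa : ∀ j, Q a j = if c r = j then 1 else 0) :
    IsEquitableQuotient (attachLeaves C r l) (Sum.elim c fun _ => a) Q := by
  refine ⟨fun j => ?_, fun v j => ?_⟩
  -- The leaf cell is nonempty only because `l ≠ 0`.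
  · by_cases hj : j = a
    · exact ⟨Sum.inr ⟨0, Nat.pos_of_ne_zero hl⟩, hj.symm⟩
    · obtain ⟨i, hi⟩ := hs j hj
      exact ⟨Sum.inl i, hi⟩
  · rcases v with i | i
    · have : c i = c r ↔ i = r := ⟨hr i, fun h => h ▸ rfl⟩
      rw [ncard_attachLeaves_inl, hN, Sum.elim_inl, hQ _ _ (ha i)]
      simp only [this]
      push_cast
      rfl
    · rw [ncard_attachLeaves_inr, Sum.elim_inr, hQa]
      push_cast
      rfl

theorem isEquitableQuotient_sameGraph (hl : l ≠ 0) :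
    IsEquitableQuotient (sameGraph l) (sameCell l) (sameQuotient ((l : ℝ) + 14)) := by
  refine isEquitableQuotient_attachLeaves
    !![0, 4, 1, 0, 0; 1, 3, 0, 0, 0; 1, 0, 0, 2, 0; 0, 0, 1, 1, 0; 0, 0, 0, 0, 0] hl
    (by decide) (by decide) (by decide) (fun i j hi => ?_) (by decide) (fun j => ?_)
  · fin_cases i <;> fin_cases j <;> first | exact absurd rfl hi | simp [sameQuotient]
  · fin_cases j <;> simp [sameQuotient]

theorem isEquitableQuotient_distinctGraph (hl : l ≠ 0) :
    IsEquitableQuotient (distinctGraph l) (distinctCell l) (distinctQuotient ((l : ℝ) + 15)) := by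
  refine isEquitableQuotient_attachLeaves
    !![0, 4, 2, 0, 0; 1, 3, 0, 0, 0; 1, 0, 0, 1, 0; 0, 0, 1, 1, 0; 0, 0, 0, 0, 0] hl
    (by decide) (by decide) (by decide) (fun i j hi => ?_) (by decide) (fun j => ?_)
  · fin_cases i <;> fin_cases j <;> first | exact absurd rfl hi | simp [distinctQuotient]
  · fin_cases j <;> simp [distinctQuotient]

theorem isEquitableQuotient_mixedGraph (hl : l ≠ 0) :
    IsEquitableQuotient (mixedGraph l) (mixedCell l) (mixedQuotient ((l : ℝ) + 14)) := by
  refine isEquitableQuotient_attachLeaves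
    !![0, 1, 3, 1, 0, 0, 0; 1, 0, 3, 0, 1, 0, 0; 1, 1, 2, 0, 0, 0, 0; 1, 0, 0, 0, 0, 1, 0;
      0, 1, 0, 0, 0, 1, 0; 0, 0, 0, 1, 1, 0, 0; 0, 0, 0, 0, 0, 0, 0] hl
    (by decide) (by decide) (by decide) (fun i j hi => ?_) (by decide) (fun j => ?_)
  · fin_cases i <;> fin_cases j <;> first | exact absurd rfl hi | simp [mixedQuotient]
  · fin_cases j <;> simp [mixedQuotient]

end Equitable

/-! ### Degrees and numbers of edges -/

section Degrees

variable {n : ℕ} {C : SimpleGraph (Fin n)} {r : Fin n} {l : ℕ}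

theorem ncard_neighborSet_attachLeaves_inl [DecidableRel C.Adj] (i : Fin n) :
    ((attachLeaves C r l).neighborSet (Sum.inl i)).ncard
      = (Finset.univ.filter fun w => C.Adj i w).card + if i = r then l else 0 := by
  -- The degree is the neighbour count for the partition into a single cell.
  have := ncard_attachLeaves_inl (C := C) (r := r) (l := l) (fun _ => (0 : Fin 1)) 0 0 i
  simp only [and_true] at this
  rw [← this]
  congr 1
  ext (w | w) <;> simp

theorem ncard_neighborSet_attachLeaves_inr (i : Fin l) :
    ((attachLeaves C r l).neighborSet (Sum.inr i)).ncard = 1 := by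
  have := ncard_attachLeaves_inr (C := C) (r := r) (l := l) (fun _ => (0 : Fin 1)) 0 0 i
  simp only [if_true] at this
  rw [← this]
  congr 1
  ext (w | w) <;> simp

theorem two_mul_ncard_edgeSet_attachLeaves [DecidableRel C.Adj] :
    2 * (attachLeaves C r l).edgeSet.ncard
      = ∑ i, (Finset.univ.filter fun w => C.Adj i w).card + 2 * l := by
  classical
  rw [← SimpleGraph.coe_edgeFinset, Set.ncard_coe_finset,
    ← SimpleGraph.sum_degrees_eq_twice_card_edges]
  have hd : ∀ v, (attachLeaves C r l).degree v = ((attachLeaves C r l).neighborSet v).ncard :=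
    fun v => by rw [← SimpleGraph.card_neighborSet_eq_degree, Set.ncard_eq_toFinset_card',
      Set.toFinset_card]
  simp only [hd, Fintype.sum_sum_type, ncard_neighborSet_attachLeaves_inl,
    ncard_neighborSet_attachLeaves_inr, Finset.sum_add_distrib, Finset.sum_ite_eq',
    Finset.mem_univ, if_true, Finset.sum_const, Finset.card_univ, Fintype.card_fin, smul_eq_mul]
  ring

theorem ncard_edgeSet_sameGraph (l : ℕ) : (sameGraph l).edgeSet.ncard = l + 14 := by
  have := two_mul_ncard_edgeSet_attachLeaves (r := 0) (l := l)
    (C := k5With 8 [(0, 5), (5, 6), (5, 7), (6, 7)])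
  rw [show ∑ i, (Finset.univ.filter fun w =>
    (k5With 8 [(0, 5), (5, 6), (5, 7), (6, 7)]).Adj i w).card = 28 by decide] at this
  rw [sameGraph]
  omega

theorem ncard_edgeSet_distinctGraph (l : ℕ) : (distinctGraph l).edgeSet.ncard = l + 15 := by
  have := two_mul_ncard_edgeSet_attachLeaves (r := 0) (l := l)
    (C := k5With 9 [(0, 5), (0, 6), (5, 7), (6, 8), (7, 8)])
  rw [show ∑ i, (Finset.univ.filter fun w =>
    (k5With 9 [(0, 5), (0, 6), (5, 7), (6, 8), (7, 8)]).Adj i w).card = 30 by decide] at this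
  rw [distinctGraph]
  omega

theorem ncard_edgeSet_mixedGraph (l : ℕ) : (mixedGraph l).edgeSet.ncard = l + 14 := by
  have := two_mul_ncard_edgeSet_attachLeaves (r := 0) (l := l)
    (C := k5With 8 [(0, 5), (1, 6), (5, 7), (6, 7)])
  rw [show ∑ i, (Finset.univ.filter fun w =>
    (k5With 8 [(0, 5), (1, 6), (5, 7), (6, 7)]).Adj i w).card = 28 by decide] at this
  rw [mixedGraph]
  omega

end Degrees

/-! ### The families are told apart by their degrees -/

section Disjoint

/-- The vertex `z` has degree three, a degree that does not occur in the other two families. -/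
theorem exists_degree_eq_three_sameGraph (l : ℕ) :
    ∃ v, ((sameGraph l).neighborSet v).ncard = 3 :=
  ⟨Sum.inl 5, by
    rw [sameGraph, ncard_neighborSet_attachLeaves_inl, if_neg (by decide)]
    decide⟩

theorem degree_distinctGraph_inl (l : ℕ) (i : Fin 9) :
    ((distinctGraph l).neighborSet (Sum.inl i)).ncard
      = ![6, 4, 4, 4, 4, 2, 2, 2, 2] i + if i = 0 then l else 0 := by
  rw [distinctGraph, ncard_neighborSet_attachLeaves_inl]
  congr 1
  revert i
  decide

theorem degree_mixedGraph_inl (l : ℕ) (i : Fin 8) :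
    ((mixedGraph l).neighborSet (Sum.inl i)).ncard
      = ![5, 5, 4, 4, 4, 2, 2, 2] i + if i = 0 then l else 0 := by
  rw [mixedGraph, ncard_neighborSet_attachLeaves_inl]
  congr 1
  revert i
  decide

theorem degree_distinctGraph_ne_three (l : ℕ) (v : Fin 9 ⊕ Fin l) :
    ((distinctGraph l).neighborSet v).ncard ≠ 3 := by
  rcases v with i | i
  · rw [degree_distinctGraph_inl]
    fin_cases i <;> simp
    omega
  · rw [distinctGraph, ncard_neighborSet_attachLeaves_inr]
    decide

theorem degree_mixedGraph_ne_three (l : ℕ) (v : Fin 8 ⊕ Fin l) :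
    ((mixedGraph l).neighborSet v).ncard ≠ 3 := by
  rcases v with i | i
  · rw [degree_mixedGraph_inl]
    fin_cases i <;> simp
    omega
  · rw [mixedGraph, ncard_neighborSet_attachLeaves_inr]
    decide

/-- Separates this family from the mixed one, where both `u` and `a` have degree at least five. -/
theorem eq_of_five_le_degree_distinctGraph (l : ℕ) (v : Fin 9 ⊕ Fin l)
    (hv : 5 ≤ ((distinctGraph l).neighborSet v).ncard) : v = Sum.inl 0 := by
  rcases v with i | i
  · rw [degree_distinctGraph_inl] at hv
    fin_cases i <;> simp at hv ⊢
  · rw [distinctGraph, ncard_neighborSet_attachLeaves_inr] at hv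
    omega

theorem exists_two_five_le_degree_mixedGraph (l : ℕ) :
    ∃ v w, v ≠ w ∧ 5 ≤ ((mixedGraph l).neighborSet v).ncard ∧
      5 ≤ ((mixedGraph l).neighborSet w).ncard :=
  ⟨Sum.inl 0, Sum.inl 1, by simp, by simp [degree_mixedGraph_inl],
    by simp [degree_mixedGraph_inl]⟩

theorem ncard_neighborSet_congr {V V' : Type*} {G : SimpleGraph V} {G' : SimpleGraph V'}
    (e : G ≃g G') (v : V) : (G'.neighborSet (e v)).ncard = (G.neighborSet v).ncard :=
  (Nat.card_congr (e.mapNeighborSet v)).symm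

variable {V : Type*} {G : SimpleGraph V} {m : ℕ}

theorem not_inSame_and_inDistinct : ¬ (InSame G m ∧ InDistinct G m) := by
  rintro ⟨⟨l, -, ⟨e⟩⟩, ⟨l', -, ⟨e'⟩⟩⟩
  obtain ⟨v, hv⟩ := exists_degree_eq_three_sameGraph l
  refine degree_distinctGraph_ne_three l' ((e.symm.trans e') v) ?_
  rw [ncard_neighborSet_congr, hv]

theorem not_inSame_and_inMixed : ¬ (InSame G m ∧ InMixed G m) := by
  rintro ⟨⟨l, -, ⟨e⟩⟩, ⟨l', -, ⟨e'⟩⟩⟩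
  obtain ⟨v, hv⟩ := exists_degree_eq_three_sameGraph l
  refine degree_mixedGraph_ne_three l' ((e.symm.trans e') v) ?_
  rw [ncard_neighborSet_congr, hv]

theorem not_inDistinct_and_inMixed : ¬ (InDistinct G m ∧ InMixed G m) := by
  rintro ⟨⟨l, -, ⟨e⟩⟩, ⟨l', -, ⟨e'⟩⟩⟩
  obtain ⟨v, w, hvw, hv, hw⟩ := exists_two_five_le_degree_mixedGraph l'
  let f := e'.symm.trans e
  refine hvw (f.injective ((eq_of_five_le_degree_distinctGraph l (f v) ?_).trans
    (eq_of_five_le_degree_distinctGraph l (f w) ?_).symm))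
  · rwa [ncard_neighborSet_congr]
  · rwa [ncard_neighborSet_congr]

end Disjoint

/-! ### Comparison of the families with `ρ'(m)` -/

section Bounds

variable {n : ℕ} {C : SimpleGraph (Fin n)} {r : Fin n} {l : ℕ}

/-- A supersolution that is constant on the leaves reduces the bound to finitely many inequalities,
uniformly in `l`. -/
theorem graphRho_attachLeaves_le [DecidableRel C.Adj] {c : ℝ} (hc : 0 ≤ c) (y : Fin n → ℝ)
    {b : ℝ} (hy : ∀ i, 0 < y i) (hb : 0 < b)
    (h : ∀ i, (∑ w, if C.Adj i w then y w else 0) + (if i = r then l * b else 0) ≤ c * y i)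
    (hr : y r ≤ c * b) : graphRho (attachLeaves C r l) ≤ c := by
  classical
  refine graphRho_le_of_supersolution _ hc (Sum.elim y fun _ => b) ?_ ?_
  · rintro (i | i)
    exacts [hy i, hb]
  · rintro (i | i)
    · rw [Finset.sum_filter, Fintype.sum_sum_type]
      simpa using h i
    · rw [Finset.sum_filter, Fintype.sum_sum_type]
      simpa using hr

theorem lt_rhoPrime {m : ℕ} (hm : 6 ≤ m) {c : ℝ} (hcm : c ≤ m)
    (hc : c ^ 4 - m * c ^ 2 - (m - 2) * c + (m / 2 - 1) < 0) : c < rhoPrime m := by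
  have hev : ∀ x : ℝ, (pPoly m).eval x
      = x ^ 4 - (m : ℝ) * x ^ 2 - ((m : ℝ) - 2) * x + ((m : ℝ) / 2 - 1) := by
    intro x; simp [pPoly]
  have hm' : (6 : ℝ) ≤ m := by exact_mod_cast hm
  have h := intermediate_value_Icc hcm (pPoly m).continuous.continuousOn
  have h0 : (0 : ℝ) ∈ Set.Icc ((pPoly m).eval c) ((pPoly m).eval (m : ℝ)) := by
    rw [hev, hev]
    refine ⟨hc.le, ?_⟩
    have : (0 : ℝ) ≤ (m : ℝ) ^ 2 * (m * (m - 1) - 1) := by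
      apply mul_nonneg (sq_nonneg _)
      nlinarith
    nlinarith
  obtain ⟨x, hx, hx0⟩ := h h0
  refine lt_of_lt_of_le (lt_of_le_of_ne hx.1 ?_) ((rhoPrime_isGreatest m hm).2 hx0)
  rintro rfl
  have := hev c
  change (pPoly m).eval c = 0 at hx0
  linarith

/-- The real number `c` with `c² - c + 3/2 = m` is a lower bound for `ρ'(m)`. -/
theorem exists_lt_rhoPrime {m : ℕ} (hm : 18 ≤ m) :
    ∃ c : ℝ, 9 / 2 ≤ c ∧ (m : ℝ) = c ^ 2 - c + 3 / 2 ∧ c < rhoPrime m := by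
  have hm' : (18 : ℝ) ≤ m := by exact_mod_cast hm
  have hs := Real.sq_sqrt (show (0 : ℝ) ≤ m - 5 / 4 by linarith)
  have h4 : 4 ≤ √((m : ℝ) - 5 / 4) := Real.le_sqrt_of_sq_le (by linarith)
  set s := √((m : ℝ) - 5 / 4)
  have hmc : (m : ℝ) = (1 / 2 + s) ^ 2 - (1 / 2 + s) + 3 / 2 := by linarith
  refine ⟨1 / 2 + s, by linarith, hmc, lt_rhoPrime (by omega) (by nlinarith) ?_⟩
  -- For `m = c² - c + k` the value `p_m(c)` is `(3/2 - k)(c² + c) + k/2 - 1`; the choice `k = 3/2`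
  -- makes it constant.
  have : (1 / 2 + s) ^ 4 - m * (1 / 2 + s) ^ 2 - (m - 2) * (1 / 2 + s) + ((m : ℝ) / 2 - 1)
      = - 1 / 4 := by
    rw [hmc]; ring
  rw [this]
  norm_num

/-- The vector solves the eigenvalue equations for `c` at every vertex except `u`, with denominators
cleared; the only genuine inequality is the one at `u`. -/
theorem graphRho_sameGraph_le {c : ℝ} (hc : 9 / 2 ≤ c) (hl : (l : ℝ) = c ^ 2 - c - 25 / 2) :
    graphRho (sameGraph l) ≤ c := by
  have hE : 0 < c ^ 2 - c - 2 := by nlinarith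
  have h3 : 0 < c - 3 := by linarith
  have h1 : 0 < c - 1 := by linarith
  have h0 : 0 < c := by linarith
  set E := c ^ 2 - c - 2 with hEdef
  refine graphRho_attachLeaves_le h0.le
    ![c * (c - 3) * E, c * E, c * E, c * E, c * E, c * (c - 3) * (c - 1), c * (c - 3),
      c * (c - 3)] (b := (c - 3) * E) ?_ (by positivity) ?_ ?_
  · intro i; fin_cases i <;> simp <;> positivity
  · intro i
    rw [Fin.sum_univ_eight]
    fin_cases i <;> simp [k5With]
    · rw [hl, hEdef]
      -- Expanded around `9/2`, the difference of the two sides is a polynomial in `s ≥ 0` that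
      -- `positivity` can handle.
      obtain ⟨s, hs, rfl⟩ : ∃ s : ℝ, 0 ≤ s ∧ c = 9 / 2 + s := ⟨c - 9 / 2, by linarith, by ring⟩
      rw [← sub_nonneg]
      ring_nf
      positivity
    all_goals linarith
  · simp
    linarith

theorem graphRho_distinctGraph_le {c : ℝ} (hc : 9 / 2 ≤ c) (hl : (l : ℝ) = c ^ 2 - c - 27 / 2) :
    graphRho (distinctGraph l) ≤ c := by
  have hE : 0 < c ^ 2 - c - 1 := by nlinarith
  have h3 : 0 < c - 3 := by linarith
  have h1 : 0 < c - 1 := by linarith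
  have h0 : 0 < c := by linarith
  set E := c ^ 2 - c - 1 with hEdef
  refine graphRho_attachLeaves_le h0.le
    ![c * (c - 3) * E, c * E, c * E, c * E, c * E, c * (c - 3) * (c - 1),
      c * (c - 3) * (c - 1), c * (c - 3), c * (c - 3)] (b := (c - 3) * E) ?_ (by positivity) ?_ ?_
  · intro i; fin_cases i <;> simp <;> positivity
  · intro i
    rw [Fin.sum_univ_succ, Fin.sum_univ_eight]
    fin_cases i <;> simp [k5With]
    · rw [hl, hEdef]
      obtain ⟨s, hs, rfl⟩ : ∃ s : ℝ, 0 ≤ s ∧ c = 9 / 2 + s := ⟨c - 9 / 2, by linarith, by ring⟩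
      rw [← sub_nonneg]
      ring_nf
      positivity
    all_goals linarith
  · simp
    linarith

/-- The vector is not the exact solution away from `u`: it is constant on `A⁺` and equal at `x` and
`y`. This costs slack at `A⁺ \ {a}` and at `y` but keeps the entries simple. -/
theorem graphRho_mixedGraph_le {c : ℝ} (hc : 9 / 2 ≤ c) (hl : (l : ℝ) = c ^ 2 - c - 25 / 2) :
    graphRho (mixedGraph l) ≤ c := by
  have hE : 0 < c ^ 2 - 4 * c + 2 := by nlinarith
  have h3 : 0 < c - 3 := by linarith
  have h1 : 0 < c - 1 := by linarith
  have h0 : 0 < c := by linarith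
  set E := c ^ 2 - 4 * c + 2 with hEdef
  refine graphRho_attachLeaves_le h0.le
    ![c * E, c * (c - 1), c * (c - 1), c * (c - 1), c * (c - 1), (c - 1) * (c - 3), c, c]
    (b := E) ?_ hE ?_ ?_
  · intro i; fin_cases i <;> simp <;> positivity
  · intro i
    rw [Fin.sum_univ_eight]
    fin_cases i <;> simp [k5With]
    · rw [hl, hEdef]
      obtain ⟨s, hs, rfl⟩ : ∃ s : ℝ, 0 ≤ s ∧ c = 9 / 2 + s := ⟨c - 9 / 2, by linarith, by ring⟩
      rw [← sub_nonneg]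
      ring_nf
      positivity
    all_goals first | (rw [hEdef]; nlinarith) | nlinarith
  · simp

theorem graphRho_sameGraph_lt {m : ℕ} (hm : 18 ≤ m) (hl : m = l + 14) :
    graphRho (sameGraph l) < rhoPrime m := by
  obtain ⟨c, hc, hmc, hlt⟩ := exists_lt_rhoPrime hm
  have : (m : ℝ) = l + 14 := by exact_mod_cast hl
  exact (graphRho_sameGraph_le hc (by linarith)).trans_lt hlt

theorem graphRho_distinctGraph_lt {m : ℕ} (hm : 18 ≤ m) (hl : m = l + 15) :
    graphRho (distinctGraph l) < rhoPrime m := by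
  obtain ⟨c, hc, hmc, hlt⟩ := exists_lt_rhoPrime hm
  have : (m : ℝ) = l + 15 := by exact_mod_cast hl
  exact (graphRho_distinctGraph_le hc (by linarith)).trans_lt hlt

theorem graphRho_mixedGraph_lt {m : ℕ} (hm : 18 ≤ m) (hl : m = l + 14) :
    graphRho (mixedGraph l) < rhoPrime m := by
  obtain ⟨c, hc, hmc, hlt⟩ := exists_lt_rhoPrime hm
  have : (m : ℝ) = l + 14 := by exact_mod_cast hl
  exact (graphRho_mixedGraph_le hc (by linarith)).trans_lt hlt

end Bounds

/-! ### Classification of admissible graphs -/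

section Classification

/-- A graph all of whose vertices outside an induced core `C` are leaves at the vertex `r` of the
core is `C` with leaves attached at `r`. -/
theorem exists_iso_attachLeaves {V : Type*} [Finite V] {G : SimpleGraph V} {n : ℕ}
    {C : SimpleGraph (Fin n)} {r : Fin n} (f : Fin n → V) (hne : ∀ i j, i < j → f i ≠ f j)
    (hadj : ∀ i j, i < j → (G.Adj (f i) (f j) ↔ C.Adj i j))
    (hout : ∀ v, (∀ i, f i ≠ v) → ∀ w, G.Adj v w ↔ w = f r) :
    ∃ l, ∃ e : G ≃g attachLeaves C r l, e (f r) = Sum.inl r := by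
  classical
  have hinj : Function.Injective f := fun i j hij => by
    rcases lt_trichotomy i j with h | h | h
    exacts [(hne _ _ h hij).elim, h, (hne _ _ h hij.symm).elim]
  have hadj' : ∀ i j, G.Adj (f i) (f j) ↔ C.Adj i j := fun i j => by
    rcases lt_trichotomy i j with h | rfl | h
    · exact hadj _ _ h
    · simp
    · rw [G.adj_comm, C.adj_comm, hadj _ _ h]
  obtain ⟨l, ⟨g⟩⟩ := Finite.exists_equiv_fin ((Set.range f)ᶜ : Set V)
  let e : Fin n ⊕ Fin l ≃ V :=
    (Equiv.sumCongr (Equiv.ofInjective f hinj) g.symm).trans (Equiv.Set.sumCompl (Set.range f))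
  have he1 : ∀ i, e (Sum.inl i) = f i := fun i => by simp [e]
  have he2 : ∀ i j, f j ≠ e (Sum.inr i) := fun i j h => by
    have h2 : e (Sum.inr i) = (g.symm i : V) := by simp [e]
    rw [h2] at h
    exact (g.symm i).2 ⟨j, h⟩
  have h2 : ∀ i v, G.Adj (e (Sum.inr i)) v ↔ v = f r := fun i => hout _ (he2 i)
  refine ⟨l, (⟨e, fun {v w} => ?_⟩ : attachLeaves C r l ≃g G).symm, ?_⟩
  · rcases v with i | i <;> rcases w with j | j
    · simp [he1, hadj']
    · rw [G.adj_comm, h2, he1, hinj.eq_iff, attachLeaves_adj_inl_inr]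
    · rw [h2, he1, hinj.eq_iff, attachLeaves_adj_inr_inl]
    · simp [h2, (he2 _ _).symm]
  · exact e.symm_apply_eq.2 (he1 r).symm

/-- The structure of a graph with `A⁺ = range a` a clique on four vertices, and with `W = {x, y}`,
where `x`, `y` are adjacent and have one further neighbour each, `p` and `q`. -/
structure IsCore {V : Type*} (G : SimpleGraph V) (u : V) (a : Fin 4 → V) (x y p q : V) :
    Prop where
  inj : Function.Injective a
  adj_a (i) : G.Adj u (a i)
  clique (i j) (h : i ≠ j) : G.Adj (a i) (a j)
  mem_range (v w) (hv : G.Adj u v) (hw : G.Adj u w) (h : G.Adj v w) : ∃ i, a i = v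
  x_ne : x ≠ u
  y_ne : y ≠ u
  not_adj_x : ¬ G.Adj u x
  not_adj_y : ¬ G.Adj u y
  eq_or_eq (v) (hv : v ≠ u) (h : ¬ G.Adj u v) : v = x ∨ v = y
  adj_x (v) : G.Adj x v ↔ v = y ∨ v = p
  adj_y (v) : G.Adj y v ↔ v = x ∨ v = q
  adj_p : G.Adj u p
  adj_q : G.Adj u q

variable {V : Type*} {G : SimpleGraph V} {u x y p q : V} {a : Fin 4 → V} {m : ℕ}

namespace IsCore

theorem swap (h : IsCore G u a x y p q) : IsCore G u a y x q p :=
  ⟨h.inj, h.adj_a, h.clique, h.mem_range, h.y_ne, h.x_ne, h.not_adj_y, h.not_adj_x,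
    fun v hv hv' => (h.eq_or_eq v hv hv').symm, h.adj_y, h.adj_x, h.adj_q, h.adj_p⟩

theorem comp_perm (h : IsCore G u a x y p q) (σ : Equiv.Perm (Fin 4)) :
    IsCore G u (a ∘ σ) x y p q :=
  { h with
    inj := h.inj.comp σ.injective
    adj_a := fun i => h.adj_a _
    clique := fun i j hij => h.clique _ _ (σ.injective.ne hij)
    mem_range := fun v w hv hw hvw => by
      obtain ⟨i, hi⟩ := h.mem_range v w hv hw hvw
      exact ⟨σ.symm i, by simpa using hi⟩ }

theorem adj_xy (h : IsCore G u a x y p q) : G.Adj x y := (h.adj_x y).2 (Or.inl rfl)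

/-- A neighbour of `u` outside the core is a leaf. -/
theorem adj_iff_of_ne (h : IsCore G u a x y p q) {v : V} (hu : u ≠ v) (hx : x ≠ v) (hy : y ≠ v)
    (ha : ∀ i, a i ≠ v) (hp : p ≠ v) (hq : q ≠ v) (w : V) : G.Adj v w ↔ w = u := by
  have huv : G.Adj u v := by
    by_contra hv
    rcases h.eq_or_eq v hu.symm hv with rfl | rfl
    exacts [hx rfl, hy rfl]
  refine ⟨fun hvw => ?_, fun hw => hw ▸ huv.symm⟩
  by_contra hw
  by_cases huw : G.Adj u w
  · obtain ⟨i, hi⟩ := h.mem_range v w huv huw hvw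
    exact ha i hi
  · rcases h.eq_or_eq w hw huw with rfl | rfl
    · rcases (h.adj_x v).1 hvw.symm with h | h
      exacts [hy h.symm, hp h.symm]
    · rcases (h.adj_y v).1 hvw.symm with h | h
      exacts [hx h.symm, hq h.symm]

theorem a_ne_x (h : IsCore G u a x y p q) (i : Fin 4) : a i ≠ x :=
  fun hi => h.not_adj_x (hi ▸ h.adj_a i)

theorem a_ne_y (h : IsCore G u a x y p q) (i : Fin 4) : a i ≠ y := h.swap.a_ne_x i

theorem not_adj_of_notMem (h : IsCore G u a x y p q) {z : V} (hz : G.Adj u z)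
    (hza : ∀ i, a i ≠ z) (v : V) (hv : G.Adj u v) : ¬ G.Adj v z := fun hvz => by
  obtain ⟨i, hi⟩ := h.mem_range z v hz hv hvz.symm
  exact hza i hi

theorem adj_a_x_iff (h : IsCore G u a x y p q) (i : Fin 4) : G.Adj (a i) x ↔ a i = p := by
  rw [G.adj_comm, h.adj_x]
  exact or_iff_right (h.a_ne_y i)

theorem adj_a_y_iff (h : IsCore G u a x y p q) (i : Fin 4) : G.Adj (a i) y ↔ a i = q :=
  h.swap.adj_a_x_iff i

variable [Finite V]

theorem exists_iso_sameGraph (h : IsCore G u a x y p p) (hp : ∀ i, a i ≠ p) :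
    ∃ l, ∃ e : G ≃g sameGraph l, e u = Sum.inl 0 := by
  have hpx : p ≠ x := fun e => h.not_adj_x (e ▸ h.adj_p)
  have hpy : p ≠ y := fun e => h.not_adj_y (e ▸ h.adj_p)
  have hnp := h.not_adj_of_notMem h.adj_p hp
  refine exists_iso_attachLeaves (r := 0) ![u, a 0, a 1, a 2, a 3, p, x, y] ?_ ?_ ?_
  · intro i j hij
    fin_cases i <;> fin_cases j <;> first
      | exact absurd hij (by decide)
      | simp [h.inj.eq_iff, h.a_ne_x, h.a_ne_y, hp, hpx, hpy, h.x_ne.symm, h.y_ne.symm,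
          h.adj_xy.ne, (h.adj_a _).ne, h.adj_p.ne]
  · intro i j hij
    fin_cases i <;> fin_cases j <;> first
      | exact absurd hij (by decide)
      | simp [k5With, h.adj_a, h.adj_p, h.clique, h.not_adj_x, h.not_adj_y, hnp, h.adj_a_x_iff,
          h.adj_a_y_iff, hp, h.adj_xy, G.adj_comm p, h.adj_x, h.adj_y]
  · intro v hv
    refine h.adj_iff_of_ne (hv 0) (hv 6) (hv 7) (fun i => ?_) (hv 5) (hv 5)
    fin_cases i
    exacts [hv 1, hv 2, hv 3, hv 4]

theorem exists_iso_distinctGraph (h : IsCore G u a x y p q) (hp : ∀ i, a i ≠ p)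
    (hq : ∀ i, a i ≠ q) (hpq : p ≠ q) :
    ∃ l, ∃ e : G ≃g distinctGraph l, e u = Sum.inl 0 := by
  have hpx : p ≠ x := fun e => h.not_adj_x (e ▸ h.adj_p)
  have hpy : p ≠ y := fun e => h.not_adj_y (e ▸ h.adj_p)
  have hqx : q ≠ x := fun e => h.not_adj_x (e ▸ h.adj_q)
  have hqy : q ≠ y := fun e => h.not_adj_y (e ▸ h.adj_q)
  have hnp := h.not_adj_of_notMem h.adj_p hp
  have hnq := h.not_adj_of_notMem h.adj_q hq
  have hpx' : G.Adj p x := ((h.adj_x p).2 (Or.inr rfl)).symm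
  have hqy' : G.Adj q y := ((h.adj_y q).2 (Or.inr rfl)).symm
  have hpy' : ¬ G.Adj p y := fun e => by simpa [hpx, hpq] using (h.adj_y p).1 e.symm
  have hqx' : ¬ G.Adj q x := fun e => by simpa [hqy, hpq.symm] using (h.adj_x q).1 e.symm
  refine exists_iso_attachLeaves (r := 0) ![u, a 0, a 1, a 2, a 3, p, q, x, y] ?_ ?_ ?_
  · intro i j hij
    fin_cases i <;> fin_cases j <;> first
      | exact absurd hij (by decide)
      | simp [h.inj.eq_iff, h.a_ne_x, h.a_ne_y, hp, hq, hpq, hpx, hpy, hqx, hqy, h.x_ne.symm,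
          h.y_ne.symm, h.adj_xy.ne, (h.adj_a _).ne, h.adj_p.ne, h.adj_q.ne]
  · intro i j hij
    fin_cases i <;> fin_cases j <;> first
      | exact absurd hij (by decide)
      | simp [k5With, h.adj_a, h.adj_p, h.adj_q, h.clique, h.not_adj_x, h.not_adj_y, hnp, hnq,
          h.adj_a_x_iff, h.adj_a_y_iff, hp, hq, h.adj_xy, hpx', hpy', hqx', hqy']
  · intro v hv
    refine h.adj_iff_of_ne (hv 0) (hv 7) (hv 8) (fun i => ?_) (hv 5) (hv 6)
    fin_cases i
    exacts [hv 1, hv 2, hv 3, hv 4]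

theorem exists_iso_mixedGraph (h : IsCore G u a x y p q) (hp : ∃ i, a i = p)
    (hq : ∀ i, a i ≠ q) : ∃ l, ∃ e : G ≃g mixedGraph l, e u = Sum.inl 0 := by
  obtain ⟨i₀, rfl⟩ := hp
  -- Relabel `A⁺` so that the neighbour of `x` comes first, as in the model graph.
  obtain ⟨b, hb, h, hq⟩ : ∃ b : Fin 4 → V, b 0 = a i₀ ∧ IsCore G u b x y (a i₀) q ∧
      ∀ i, b i ≠ q :=
    ⟨a ∘ Equiv.swap 0 i₀, by simp, h.comp_perm _, fun i => hq _⟩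
  rw [← hb] at h
  have hqx : q ≠ x := fun e => h.not_adj_x (e ▸ h.adj_q)
  have hqy : q ≠ y := fun e => h.not_adj_y (e ▸ h.adj_q)
  have hnq := h.not_adj_of_notMem h.adj_q hq
  have hqy' : G.Adj q y := ((h.adj_y q).2 (Or.inr rfl)).symm
  have hqx' : ¬ G.Adj q x := fun e => by simpa [hqy, (hq 0).symm] using (h.adj_x q).1 e.symm
  refine exists_iso_attachLeaves (r := 0) ![u, b 0, b 1, b 2, b 3, q, x, y] ?_ ?_ ?_
  · intro i j hij
    fin_cases i <;> fin_cases j <;> first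
      | exact absurd hij (by decide)
      | simp [h.inj.eq_iff, h.a_ne_x, h.a_ne_y, hq, hqx, hqy, h.x_ne.symm,
          h.y_ne.symm, h.adj_xy.ne, (h.adj_a _).ne, h.adj_q.ne]
  · intro i j hij
    fin_cases i <;> fin_cases j <;> first
      | exact absurd hij (by decide)
      | simp [k5With, h.adj_a, h.adj_q, h.clique, h.not_adj_x, h.not_adj_y, hnq,
          h.adj_a_x_iff, h.adj_a_y_iff, hq, h.adj_xy, hqx', hqy', h.inj.eq_iff]
  · intro v hv
    refine h.adj_iff_of_ne (hv 0) (hv 6) (hv 7) (fun i => ?_) (hv 1) (hv 5)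
    fin_cases i
    exacts [hv 1, hv 2, hv 3, hv 4]

end IsCore

/-- Supplies the two vertices of `A⁺` needed to complete a fish, whichever two vertices are already
in use. -/
theorem exists_two_ne_of_injective (ha : Function.Injective a) (p q : V) :
    ∃ i j, i ≠ j ∧ a i ≠ p ∧ a i ≠ q ∧ a j ≠ p ∧ a j ≠ q := by
  classical
  have h : 1 < ((Finset.univ.image a) \ {p, q}).card := by
    have h1 := Finset.le_card_sdiff {p, q} (Finset.univ.image a)
    have h2 := Finset.card_le_two (a := p) (b := q)
    rw [Finset.card_image_of_injective _ ha, Finset.card_univ, Fintype.card_fin] at h1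
    omega
  obtain ⟨b, hb, c, hc, hbc⟩ := Finset.one_lt_card.1 h
  simp only [Finset.mem_sdiff, Finset.mem_image, Finset.mem_univ, true_and, Finset.mem_insert,
    Finset.mem_singleton, not_or] at hb hc
  obtain ⟨⟨i, rfl⟩, hb1, hb2⟩ := hb
  obtain ⟨⟨j, rfl⟩, hc1, hc2⟩ := hc
  exact ⟨i, j, fun h => hbc (h ▸ rfl), hb1, hb2, hc1, hc2⟩

theorem exists_enum_Aplus (h : AplusIsK4 G u) : ∃ a : Fin 4 → V, Function.Injective a ∧
    (∀ i, G.Adj u (a i)) ∧ (∀ i j, i ≠ j → G.Adj (a i) (a j)) ∧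
    ∀ v w, G.Adj u v → G.Adj u w → G.Adj v w → ∃ i, a i = v := by
  obtain ⟨e⟩ := h
  refine ⟨fun i => e.symm i, Subtype.val_injective.comp e.symm.injective,
    fun i => (e.symm i).2.1, fun i j hij => ?_, fun v w hv hw hvw =>
      ⟨e ⟨v, hv, w, hw, hvw⟩, by simp⟩⟩
  have : (G.induce (Aplus G u)).Adj (e.symm i) (e.symm j) := e.symm.map_adj_iff.2 hij
  exact this

theorem exists_unique_edge_Wset (h : eW G u = 1) : ∃ x y, x ∈ Wset G u ∧ y ∈ Wset G u ∧
    G.Adj x y ∧ ∀ v w, v ∈ Wset G u → w ∈ Wset G u → G.Adj v w →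
      (v = x ∧ w = y) ∨ (v = y ∧ w = x) := by
  obtain ⟨e, he⟩ := Set.ncard_eq_one.1 h
  induction e using Sym2.ind with
  | _ x y =>
    have hxy : s(x, y) ∈ (G.induce (Wset G u)).edgeSet := he ▸ rfl
    refine ⟨x, y, x.2, y.2, hxy, fun v w hv hw hvw => ?_⟩
    have : s(⟨v, hv⟩, ⟨w, hw⟩) ∈ (G.induce (Wset G u)).edgeSet := hvw
    rw [he] at this
    rcases Sym2.eq_iff.1 this with ⟨h1, h2⟩ | ⟨h1, h2⟩
    · exact Or.inl ⟨congrArg Subtype.val h1, congrArg Subtype.val h2⟩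
    · exact Or.inr ⟨congrArg Subtype.val h1, congrArg Subtype.val h2⟩

theorem IsAdmissible.exists_isCore [Finite V] (h : IsAdmissible G u m) :
    ∃ a x y p q, IsCore G u a x y p q := by
  obtain ⟨a, hinj, hua, hcl, hmem⟩ := exists_enum_Aplus h.k4
  obtain ⟨x, y, hx, hy, hxy, huniq⟩ := exists_unique_edge_Wset h.eW_eq
  -- Otherwise the 4-cycle `u p w q` and the triangle `u (a i) (a j)` form a fish.
  have hone : ∀ w ∈ Wset G u, ∀ p q, G.Adj u p → G.Adj u q → G.Adj w p → G.Adj w q → p = q := by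
    intro w hw p q hp hq hwp hwq
    by_contra hpq
    obtain ⟨i, j, hij, hip, hiq, hjp, hjq⟩ := exists_two_ne_of_injective hinj p q
    have hwa : ∀ i, w ≠ a i := fun i hi => hw.2 (hi ▸ hua i)
    exact h.free.not_fish hp hwp.symm hwq hq.symm (hua i) (hcl i j hij) (hua j).symm
      hw.1.symm hpq hip.symm hjp.symm (hwa i) (hwa j) hiq.symm hjq.symm
  have htwo : ∀ w ∈ Wset G u, ∀ t, ∃ p, p ≠ t ∧ G.Adj w p := by
    intro w hw t
    obtain ⟨p, hp, hpt⟩ := Set.exists_ne_of_one_lt_ncard (h.two_le_deg w hw) t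
    exact ⟨p, hpt, hp⟩
  have hu : ∀ w ∈ Wset G u, ∀ p, G.Adj w p → p ≠ u := by
    rintro w hw p hp rfl
    exact hw.2 hp.symm
  have hnbr : ∀ x y, x ∈ Wset G u → G.Adj x y → y ∈ Wset G u →
      (∀ w ∈ Wset G u, G.Adj x w → w = y) → ∃ p, G.Adj u p ∧ ∀ v, G.Adj x v ↔ v = y ∨ v = p := by
    intro x y hx hxy hy huniq
    have key : ∀ v, v ≠ y → G.Adj x v → G.Adj u v := fun v hv hxv => by
      by_contra huv
      exact hv (huniq v ⟨hu x hx v hxv, huv⟩ hxv)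
    obtain ⟨p, hpy, hp⟩ := htwo x hx y
    refine ⟨p, key p hpy hp, fun v => ⟨fun hv => ?_, ?_⟩⟩
    · by_cases hvy : v = y
      · exact Or.inl hvy
      · exact Or.inr (hone x hx v p (key v hvy hv) (key p hpy hp) hv hp)
    · rintro (rfl | rfl)
      exacts [hxy, hp]
  obtain ⟨p, hup, hxp⟩ := hnbr x y hx hxy hy fun w hw hxw => by
    rcases huniq x w hx hw hxw with h | h
    exacts [h.2, (hxy.ne h.1).elim]
  obtain ⟨q, huq, hyq⟩ := hnbr y x hy hxy.symm hx fun w hw hyw => by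
    rcases huniq y w hy hw hyw with h | h
    exacts [(hxy.ne h.1.symm).elim, h.2]
  refine ⟨a, x, y, p, q, hinj, hua, hcl, hmem, hx.1, hy.1, hx.2, hy.2, fun v hv huv => ?_,
    hxp, hyq, hup, huq⟩
  -- A vertex of `W` off the edge `xy` has all its neighbours in `N`; there are at least two of
  -- them, against `hone`.
  by_contra! hne
  have hvN : ∀ s, G.Adj v s → G.Adj u s := fun s hs => by
    by_contra hus
    rcases huniq v s ⟨hv, huv⟩ ⟨hu v ⟨hv, huv⟩ s hs, hus⟩ hs with h | h
    exacts [hne.1 h.1, hne.2 h.1]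
  obtain ⟨s, -, hs⟩ := htwo v ⟨hv, huv⟩ v
  obtain ⟨t, hts, ht⟩ := htwo v ⟨hv, huv⟩ s
  exact hts (hone v ⟨hv, huv⟩ t s (hvN t ht) (hvN s hs) ht hs)

/-- If `p = q`, the triangle `p x y` meets a 4-cycle through `p`, `u` and two other vertices of
`A⁺`. If `p ≠ q`, the 4-cycle `p x y q` meets the triangle of `p` and the two remaining vertices of
`A⁺`. -/
theorem IsCore.not_both_mem_range (h : IsCore G u a x y p q) (hG : fishGraph.Free G)
    (hp : ∃ i, a i = p) (hq : ∃ i, a i = q) : False := by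
  obtain ⟨k, rfl⟩ := hp
  obtain ⟨k', rfl⟩ := hq
  obtain ⟨i, j, hij, hik, hik', hjk, hjk'⟩ := exists_two_ne_of_injective h.inj (a k) (a k')
  have hki : k ≠ i := fun e => hik (e ▸ rfl)
  have hkj : k ≠ j := fun e => hjk (e ▸ rfl)
  have hkx := (h.adj_a_x_iff k).2 rfl
  by_cases hkk : k = k'
  · subst hkk
    have hky := (h.adj_a_y_iff k).2 rfl
    exact hG.not_fish (h.adj_a k).symm (h.adj_a i) (h.clique i j hij) (h.clique j k hkj.symm)
      hkx h.adj_xy hky.symm hik.symm (h.adj_a j).ne h.x_ne.symm h.y_ne.symm (h.a_ne_x i)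
      (h.a_ne_y i) (h.a_ne_x j) (h.a_ne_y j)
  · exact hG.not_fish hkx h.adj_xy ((h.adj_a_y_iff k').2 rfl).symm (h.clique k' k (Ne.symm hkk))
      (h.clique k i hki) (h.clique i j hij) (h.clique j k hkj.symm) (h.a_ne_y k)
      (h.a_ne_x k').symm (h.a_ne_x i).symm (h.a_ne_x j).symm (h.a_ne_y i).symm (h.a_ne_y j).symm
      hik'.symm hjk'.symm

theorem ncard_edgeSet_congr {V' : Type*} {G' : SimpleGraph V'} (e : G ≃g G') :
    G.edgeSet.ncard = G'.edgeSet.ncard :=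
  Nat.card_congr e.mapEdgeSet

/-- The family is decided by which of `p`, `q` lie in `A⁺` and, if neither does, by whether they
coincide; the edge count then fixes the number of leaves. -/
theorem IsAdmissible.classification [Finite V] (h : IsAdmissible G u m) :
    InSameAt G u m ∨ InDistinctAt G u m ∨ InMixedAt G u m := by
  obtain ⟨a, x, y, p, q, hc⟩ := h.exists_isCore
  by_cases hp : ∃ i, a i = p
  · by_cases hq : ∃ i, a i = q
    · exact (hc.not_both_mem_range h.free hp hq).elim
    · push Not at hq
      obtain ⟨l, e, he⟩ := hc.exists_iso_mixedGraph hp hq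
      exact Or.inr (Or.inr ⟨l, by rw [← h.size, ncard_edgeSet_congr e, ncard_edgeSet_mixedGraph],
        e, he⟩)
  · by_cases hq : ∃ i, a i = q
    · push Not at hp
      obtain ⟨l, e, he⟩ := hc.swap.exists_iso_mixedGraph hq hp
      exact Or.inr (Or.inr ⟨l, by rw [← h.size, ncard_edgeSet_congr e, ncard_edgeSet_mixedGraph],
        e, he⟩)
    · push Not at hp hq
      by_cases hpq : p = q
      · subst hpq
        obtain ⟨l, e, he⟩ := hc.exists_iso_sameGraph hp
        exact Or.inl ⟨l, by rw [← h.size, ncard_edgeSet_congr e, ncard_edgeSet_sameGraph], e, he⟩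
      · obtain ⟨l, e, he⟩ := hc.exists_iso_distinctGraph hp hq hpq
        exact Or.inr (Or.inl
          ⟨l, by rw [← h.size, ncard_edgeSet_congr e, ncard_edgeSet_distinctGraph], e, he⟩)

theorem IsAdmissible.graphRho_lt [Fintype V] (h : IsAdmissible G u m) (hm : 18 ≤ m) :
    graphRho G < rhoPrime m := by
  rcases h.classification with ⟨l, hl, e, -⟩ | ⟨l, hl, e, -⟩ | ⟨l, hl, e, -⟩
  · rw [graphRho_congr e]; exact graphRho_sameGraph_lt hm hl
  · rw [graphRho_congr e]; exact graphRho_distinctGraph_lt hm hl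
  · rw [graphRho_congr e]; exact graphRho_mixedGraph_lt hm hl

end Classification

theorem mainTheorem4 {V : Type*} [Fintype V] (G : SimpleGraph V) (u : V) (m : ℕ) (hm : Even m) :
    -- an extremal graph, decomposed at a maximal Perron entry, satisfies the degree condition
    (∀ x : V → ℝ, IsExtremal G m → IsPerronAt G u x →
      ∀ w ∈ Wset G u, 2 ≤ (G.neighborSet w).ncard) ∧
    -- classification of the admissible graphs
    (IsAdmissible G u m → InSameAt G u m ∨ InDistinctAt G u m ∨ InMixedAt G u m) ∧
    -- the three families are pairwise disjoint
    (¬ (InSame G m ∧ InDistinct G m) ∧ ¬ (InSame G m ∧ InMixed G m) ∧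
      ¬ (InDistinct G m ∧ InMixed G m)) ∧
    -- equitable quotients and their characteristic polynomials
    (16 ≤ m →
      (IsEquitableQuotient (sameGraph (m - 14)) (sameCell (m - 14)) (sameQuotient m) ∧
        (sameQuotient m).charpoly = fSame m) ∧
      (IsEquitableQuotient (distinctGraph (m - 15)) (distinctCell (m - 15)) (distinctQuotient m) ∧
        (distinctQuotient m).charpoly = fDistinct m) ∧
      (IsEquitableQuotient (mixedGraph (m - 14)) (mixedCell (m - 14)) (mixedQuotient m) ∧
        (mixedQuotient m).charpoly = fMixed m)) ∧
    -- comparison of the three families with `ρ'(m)`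
    (18 ≤ m →
      graphRho (sameGraph (m - 14)) < rhoPrime m ∧
      graphRho (distinctGraph (m - 15)) < rhoPrime m ∧
      graphRho (mixedGraph (m - 14)) < rhoPrime m) ∧
    -- the conclusion for every admissible graph
    (18 ≤ m → IsAdmissible G u m → graphRho G < rhoPrime m) ∧
    -- the conclusion in the extremal setting
    (18 ≤ m → ∀ x : V → ℝ, IsExtremal G m → IsPerronAt G u x → AplusIsK4 G u → eW G u = 1 →
      graphRho G < rhoPrime m) := by
  refine ⟨fun x hG hx w hw => two_le_degree_of_isExtremal hm hG hx hw,
    fun h => h.classification,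
    ⟨not_inSame_and_inDistinct, not_inSame_and_inMixed, not_inDistinct_and_inMixed⟩,
    fun hm16 => ?_,
    fun hm18 => ⟨graphRho_sameGraph_lt hm18 (by omega), graphRho_distinctGraph_lt hm18 (by omega),
      graphRho_mixedGraph_lt hm18 (by omega)⟩,
    fun hm18 h => h.graphRho_lt hm18,
    fun hm18 x hG hx h4 hW => ?_⟩
  · have h14 : (m : ℝ) = (m - 14 : ℕ) + 14 := by
      exact_mod_cast (show m = m - 14 + 14 by omega)
    have h15 : (m : ℝ) = (m - 15 : ℕ) + 15 := by
      exact_mod_cast (show m = m - 15 + 15 by omega)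
    refine ⟨⟨?_, charpoly_sameQuotient m⟩, ⟨?_, charpoly_distinctQuotient m⟩,
      ⟨?_, charpoly_mixedQuotient m⟩⟩
    · rw [h14]; exact isEquitableQuotient_sameGraph (by omega)
    · rw [h15]; exact isEquitableQuotient_distinctGraph (by omega)
    · rw [h14]; exact isEquitableQuotient_mixedGraph (by omega)
  · exact IsAdmissible.graphRho_lt ⟨hG.free, hG.size, h4, hW,
      fun w hw => two_le_degree_of_isExtremal hm hG hx hw⟩ hm18
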